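/- Conventions. For a semi-Riemannian manifold $(M,g)$ with Levi-Civita connection $\nabla$, let $R$ be the $(0,4)$ Riemann-Christoffel tensor with $R_{ijkl}=g(R(\partial_i,\partial_j)\partial_k,\partial_l)$, $R(X,Y)=\nabla_{[X,Y]}-[\nabla_X,\nabla_Y]$, and let $S_{jk}=g^{il}R_{ijkl}$ be its Ricci tensor. For $(0,2)$-tensors put $(A\wedge E)_{ijkl}=A_{il}E_{jk}+A_{jk}E_{il}-A_{ik}E_{jl}-A_{jl}E_{ik}$. Let $U_M\subseteq M$ be the set of points $x$ at which there is no covector $\xi$ with $(\nabla R)_x=\xi\otimes R_x$. Given smooth 1-forms $\Pi,\Psi$ on $M$, the manifold $M$ is called hyper generalized recurrent ($HGK_n$) with $(\Pi,\Psi)$ if $$\nabla R=\Pi\otimes R+\Psi\otimes g\wedge S\qquad(\ast)$$ holds at every point of $U_M$. Let $(\overline M,\overline g)$ and $(\widetilde M,\widetilde g)$ be smooth semi-Riemannian manifolds of dimensions $p$ and $n-p$, $1\le p<n$, let $f$ be a positive smooth function on $\overline M$, and let $M=\overline M\times_f\widetilde M$ be the warped product, i.e. $\overline M\times\widetilde M$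 with the metric $g=\pi^*\overline g+(f\circ\pi)\,\sigma^*\widetilde g$, where $\pi,\sigma$ are the projections. Bars and tildes denote the quantities of $\overline M$ and $\widetilde M$; for a 1-form $\omega$ on $M$, $\overline\omega$ and $\widetilde\omega$ denote its restrictions to vectors tangent to $\overline M$ and to $\widetilde M$. With $f_a=\partial_af$, indices $a,b,c,d$ on $\overline M$, and all operations on $\overline M$ taken with respect to $\overline g$, put $$T_{ab}=-\frac1{2f}\Big(\overline\nabla_bf_a-\frac1{2f}f_af_b\Big),\quad P=\frac1{4f^2}\,\overline g^{ab}f_af_b,\quad Q=f\big((n-p-1)P-\mathrm{tr}\,T\big),\quad \mathrm{tr}\,T=\overline g^{ab}T_{ab},\quad \widetilde G=\tfrac12\,\widetilde g\wedge\widetilde g .$$ Corollary. Let $\Pi,\Psi$ be smooth 1-forms on $M$. Then $M$ is an $HGK_n$ with $(\Pi,\Psi)$ if and only if the following conditions hold simultaneously at every point of $U_M$: 1. (i) $\overline\nabla\,\overline R=\overline\Pi\otimes\overline R+\overline\Psi\otimes\overline g\wedge\overline S-(n-p)\,\overline\Psi\otimes\overline g\wedge T$, (ii) $-\widetilde\Pi\otimes\overline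 R=\widetilde\Psi\otimes\overline g\wedge\overline S-(n-p)\,\widetilde\Psi\otimes\overline g\wedge T$; 2. (i) $-(df+f\,\overline\Pi)\otimes\widetilde R=f\,\overline\Psi\otimes\widetilde g\wedge\widetilde S+\big(\tfrac12f^2(P\,\overline\Pi-dP)+fQ\,\overline\Psi\big)\otimes\widetilde g\wedge\widetilde g$, (ii) $f\,\widetilde\nabla\widetilde R=f\,\widetilde\Pi\otimes\widetilde R+f\,\widetilde\Psi\otimes\widetilde g\wedge\widetilde S+\big(\tfrac12f^2P\,\widetilde\Pi+fQ\,\widetilde\Psi\big)\otimes\widetilde g\wedge\widetilde g$; 3. (i) $\overline\Psi\otimes\overline g\otimes\widetilde S=-\big[f(\overline\nabla T-\overline\Pi\otimes T)+f\,\overline\Psi\otimes(\overline S-(n-p)T)+Q\,\overline\Psi\otimes\overline g\big]\otimes\widetilde g$, (ii) $\widetilde\Psi\otimes\overline g\otimes\widetilde S=-\big[-f\,\widetilde\Pi\otimes T+f\,\widetilde\Psi\otimes(\overline S-(n-p)T)+Q\,\widetilde\Psi\otimes\overline g\big]\otimes\widetilde g$; 4. (i) $f^d\,\overline R_{abcd}=-(f_aT_{bc}-f_bT_{ac})$,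 (ii) $df\otimes\widetilde R=f^2\,dP\otimes\widetilde G$. More precisely, at each single point $x\in M$ the identity $(\ast)$ holds if and only if conditions 1-4 hold at $x$. -/

import Mathlib

open scoped Manifold ContDiff Bundle

noncomputable section

/-- The Kulkarni-Nomizu product
`(A ∧ B)_{ijkl} = A_{il} B_{jk} + A_{jk} B_{il} - A_{ik} B_{jl} - A_{jl} B_{ik}`
of two `(0,2)`-tensors on a vector space. -/
def kulkarniNomizu {V : Type*} (A B : V → V → ℝ) (i j k l : V) : ℝ :=
  A i l * B j k + A j k * B i l - A i k * B j l - A j l * B i k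

/-! ### Semi-Riemannian geometry of a metric on an open subset of a vector space

`G : E → E →L[ℝ] E →L[ℝ] ℝ` is a field of bilinear forms (the metric in a chart), `y` a point.
Vectors of `E` are regarded as constant (coordinate) vector fields. -/

namespace LocalMetric

variable {E : Type*} [NormedAddCommGroup E] [NormedSpace ℝ E]

/-- Christoffel symbols of the first kind `Γ_{uv,w}`, as a covector in the slot `w`. -/
def christoffelLower (G : E → E →L[ℝ] E →L[ℝ] ℝ) (y u v : E) : E →L[ℝ] ℝ :=
  (1 / 2 : ℝ) • (fderiv ℝ G y u v + fderiv ℝ G y v u - ((fderiv ℝ G y).flip u).flip v)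

/-- `Γ_{uv,w} = ½ (∂_u G_{vw} + ∂_v G_{uw} - ∂_w G_{uv})`. -/
theorem christoffelLower_apply (G : E → E →L[ℝ] E →L[ℝ] ℝ) (y u v w : E) :
    christoffelLower G y u v w =
      1 / 2 * (fderiv ℝ G y u v w + fderiv ℝ G y v u w - fderiv ℝ G y w u v) := by
  simp [christoffelLower]

/-- The vector metrically dual to a covector `φ`, i.e. the `v` with `G y v = φ`
(for a nondegenerate `G y` on a finite-dimensional `E`). -/
def sharp (G : E → E →L[ℝ] E →L[ℝ] ℝ) (y : E) (φ : E →L[ℝ] ℝ) : E :=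
  ContinuousLinearMap.inverse (G y) φ

/-- Christoffel symbols of the Levi-Civita connection: `Γ(u,v) = ∇_u v` for constant `u`, `v`. -/
def christoffel (G : E → E →L[ℝ] E →L[ℝ] ℝ) (y u v : E) : E :=
  sharp G y (christoffelLower G y u v)

/-- The curvature operator `R(u,v)w = ∇_v ∇_u w - ∇_u ∇_v w` on constant vector fields, i.e.
`R(X,Y) = ∇_{[X,Y]} - [∇_X, ∇_Y]`. -/
def curvOp (G : E → E →L[ℝ] E →L[ℝ] ℝ) (y u v w : E) : E :=
  fderiv ℝ (fun z => christoffel G z u w) y v - fderiv ℝ (fun z => christoffel G z v w) y u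
    + christoffel G y v (christoffel G y u w) - christoffel G y u (christoffel G y v w)

/-- The Riemann-Christoffel tensor `R_{ijkl} = G(R(i,j)k, l)`. -/
def riem (G : E → E →L[ℝ] E →L[ℝ] ℝ) (y i j k l : E) : ℝ :=
  G y (curvOp G y i j k) l

/-- The Ricci tensor `S_{jk} = G^{il} R_{ijkl}`, i.e. the trace of `u ↦ R(u,j)k`, computed in a
basis of `E`. -/
def ricci [FiniteDimensional ℝ E] (G : E → E →L[ℝ] E →L[ℝ] ℝ) (y j k : E) : ℝ :=
  ∑ i, (Module.finBasis ℝ E).coord i (curvOp G y (Module.finBasis ℝ E i) j k)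

/-- Covariant derivative `(∇_e A)(a,b)` of a `(0,2)`-tensor field. -/
def covDeriv₂ (G : E → E →L[ℝ] E →L[ℝ] ℝ) (A : E → E → E → ℝ) (y e a b : E) : ℝ :=
  fderiv ℝ (fun z => A z a b) y e - A y (christoffel G y e a) b - A y a (christoffel G y e b)

/-- Covariant derivative `(∇_e D)(i,j,k,l)` of a `(0,4)`-tensor field. -/
def covDeriv₄ (G : E → E →L[ℝ] E →L[ℝ] ℝ) (D : E → E → E → E → E → ℝ) (y e i j k l : E) : ℝ :=
  fderiv ℝ (fun z => D z i j k l) y e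
    - D y (christoffel G y e i) j k l - D y i (christoffel G y e j) k l
    - D y i j (christoffel G y e k) l - D y i j k (christoffel G y e l)

/-- The covariant derivative of the curvature tensor, `R_{ijkl,e}`. -/
def nablaRiem (G : E → E →L[ℝ] E →L[ℝ] ℝ) (y e i j k l : E) : ℝ :=
  covDeriv₄ G (riem G) y e i j k l

/-- The Hessian `∇_b f_a` of a function. -/
def hessian (G : E → E →L[ℝ] E →L[ℝ] ℝ) (f : E → ℝ) (y a b : E) : ℝ :=
  fderiv ℝ (fun z => fderiv ℝ f z a) y b - fderiv ℝ f y (christoffel G y b a)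

/-- `T_{ab} = -(1/2f) (∇_b f_a - (1/2f) f_a f_b)`. -/
def warpT (G : E → E →L[ℝ] E →L[ℝ] ℝ) (f : E → ℝ) (y a b : E) : ℝ :=
  -(1 / (2 * f y)) * (hessian G f y a b - 1 / (2 * f y) * (fderiv ℝ f y a * fderiv ℝ f y b))

/-- The covariant derivative `T_{ab,e}`. -/
def nablaWarpT (G : E → E →L[ℝ] E →L[ℝ] ℝ) (f : E → ℝ) (y e a b : E) : ℝ :=
  covDeriv₂ G (warpT G f) y e a b

/-- The metric trace `G^{ab} A_{ab}` of a bilinear form, as `∑ A(b_i, b^i)` for a basis `b_i` of `E`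
with metrically dual basis `b^i`. -/
def metricTrace [FiniteDimensional ℝ E] (G : E → E →L[ℝ] E →L[ℝ] ℝ) (y : E) (A : E → E → ℝ) : ℝ :=
  ∑ i, A (Module.finBasis ℝ E i)
    (sharp G y (LinearMap.toContinuousLinearMap ((Module.finBasis ℝ E).coord i)))

/-- The gradient `f^a`. -/
def grad (G : E → E →L[ℝ] E →L[ℝ] ℝ) (f : E → ℝ) (y : E) : E :=
  sharp G y (fderiv ℝ f y)

/-- `P = (1/4f²) G^{ab} f_a f_b`. -/
def warpP (G : E → E →L[ℝ] E →L[ℝ] ℝ) (f : E → ℝ) (y : E) : ℝ :=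
  1 / (4 * f y ^ 2) * fderiv ℝ f y (grad G f y)

end LocalMetric

/-! ### Semi-Riemannian manifolds -/

section Manifold

variable {E : Type*} [NormedAddCommGroup E] [NormedSpace ℝ E]
  {H : Type*} [TopologicalSpace H] (I : ModelWithCorners ℝ E H)
  {M : Type*} [TopologicalSpace M] [ChartedSpace H M]

/-- A field of bilinear forms on the tangent spaces of `M`. -/
abbrev BilinField (M : Type*) [TopologicalSpace M] [ChartedSpace H M] : Type _ :=
  ∀ x : M, TangentSpace I x →L[ℝ] TangentSpace I x →L[ℝ] ℝ

/-- A field of covectors on `M`. -/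
abbrev CovectorField (M : Type*) [TopologicalSpace M] [ChartedSpace H M] : Type _ :=
  ∀ x : M, TangentSpace I x →L[ℝ] ℝ

variable {I}

/-- A semi-Riemannian metric: a smooth field of symmetric nondegenerate bilinear forms. -/
structure IsSemiRiemannianMetric [IsManifold I ∞ M] (g : BilinField I M) : Prop where
  symm : ∀ (x : M) (v w : TangentSpace I x), g x v w = g x w v
  nondegenerate : ∀ (x : M) (v : TangentSpace I x), (∀ w, g x v w = 0) → v = 0
  smooth : ContMDiff I (I.prod 𝓘(ℝ, E →L[ℝ] E →L[ℝ] ℝ)) ∞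
    (fun x ↦ Bundle.TotalSpace.mk' (E →L[ℝ] E →L[ℝ] ℝ)
      (E := fun x : M ↦ TangentSpace I x →L[ℝ] TangentSpace I x →L[ℝ] ℝ) x (g x))

/-- A smooth 1-form. -/
def IsSmoothOneForm [IsManifold I ∞ M] (η : CovectorField I M) : Prop :=
  ContMDiff I (I.prod 𝓘(ℝ, E →L[ℝ] ℝ)) ∞
    (fun x ↦ Bundle.TotalSpace.mk' (E →L[ℝ] ℝ)
      (E := fun x : M ↦ TangentSpace I x →L[ℝ] ℝ) x (η x))

/-- The local expression of a field of bilinear forms in the preferred chart at `x₀`. -/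
def localForm (g : BilinField I M) (x₀ : M) (y : E) : E →L[ℝ] E →L[ℝ] ℝ :=
  let D : E →L[ℝ] E := mfderiv 𝓘(ℝ, E) I (extChartAt I x₀).symm y
  let A : E →L[ℝ] E →L[ℝ] ℝ := g ((extChartAt I x₀).symm y)
  A.bilinearComp D D

theorem localForm_apply (g : BilinField I M) (x₀ : M) (y u v : E) :
    localForm g x₀ y u v =
      g ((extChartAt I x₀).symm y) (mfderiv 𝓘(ℝ, E) I (extChartAt I x₀).symm y u)
        (mfderiv 𝓘(ℝ, E) I (extChartAt I x₀).symm y v) := rfl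

/-- The local expression of a function in the preferred chart at `x₀`. -/
def localFun (I : ModelWithCorners ℝ E H) (f : M → ℝ) (x₀ : M) (y : E) : ℝ :=
  f ((extChartAt I x₀).symm y)

/-! The tensors of `(M, g)` at a point `x` are computed in the preferred chart at `x`. The tangent
space at `x` is identified with the model space by that same chart. -/

/-- The Riemann-Christoffel curvature tensor `R`. -/
def Riem (g : BilinField I M) (x : M) (i j k l : TangentSpace I x) : ℝ :=
  LocalMetric.riem (localForm g x) (extChartAt I x x) i j k l

/-- The covariant derivative `∇R`: `nablaRiem g x e i j k l = R_{ijkl,e}`. -/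
def nablaRiem (g : BilinField I M) (x : M) (e i j k l : TangentSpace I x) : ℝ :=
  LocalMetric.nablaRiem (localForm g x) (extChartAt I x x) e i j k l

/-- The Ricci tensor `S`. -/
def Ricci [FiniteDimensional ℝ E] (g : BilinField I M) (x : M) (j k : TangentSpace I x) : ℝ :=
  LocalMetric.ricci (localForm g x) (extChartAt I x x) j k

/-- The differential `df`. -/
def dFun (I : ModelWithCorners ℝ E H) (f : M → ℝ) (x : M) (e : TangentSpace I x) : ℝ :=
  fderiv ℝ (localFun I f x) (extChartAt I x x) e

/-- The gradient of `f` with respect to `g`. -/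
def gradFun (g : BilinField I M) (f : M → ℝ) (x : M) : TangentSpace I x :=
  let v : E := LocalMetric.grad (localForm g x) (localFun I f x) (extChartAt I x x)
  v

/-- The tensor `T_{ab} = -(1/2f) (∇_b f_a - (1/2f) f_a f_b)`. -/
def tensorT (g : BilinField I M) (f : M → ℝ) (x : M) (a b : TangentSpace I x) : ℝ :=
  LocalMetric.warpT (localForm g x) (localFun I f x) (extChartAt I x x) a b

/-- The covariant derivative `∇T`: `nablaT g f x e a b = T_{ab,e}`. -/
def nablaT (g : BilinField I M) (f : M → ℝ) (x : M) (e a b : TangentSpace I x) : ℝ :=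
  LocalMetric.nablaWarpT (localForm g x) (localFun I f x) (extChartAt I x x) e a b

/-- The trace of `T` with respect to `g`. -/
def traceT [FiniteDimensional ℝ E] (g : BilinField I M) (f : M → ℝ) (x : M) : ℝ :=
  LocalMetric.metricTrace (localForm g x) (extChartAt I x x)
    (LocalMetric.warpT (localForm g x) (localFun I f x) (extChartAt I x x))

/-- The function `P = (1/4f²) g^{ab} f_a f_b`. -/
def funP (g : BilinField I M) (f : M → ℝ) (x : M) : ℝ :=
  LocalMetric.warpP (localForm g x) (localFun I f x) (extChartAt I x x)

/-- The differential `dP`. -/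
def dP (g : BilinField I M) (f : M → ℝ) (x : M) (e : TangentSpace I x) : ℝ :=
  fderiv ℝ (LocalMetric.warpP (localForm g x) (localFun I f x)) (extChartAt I x x) e

/-- The function `Q = f ((m - 1) P - tr T)`, where `m` is the dimension of the fiber. -/
def funQ [FiniteDimensional ℝ E] (g : BilinField I M) (f : M → ℝ) (m : ℕ) (x : M) : ℝ :=
  f x * (((m : ℝ) - 1) * funP g f x - traceT g f x)

/-- The identity `∇R = Π ⊗ R + Ψ ⊗ (g ∧ S)` at the point `x`. -/
def HGKEquationAt [FiniteDimensional ℝ E] (g : BilinField I M) (Pi Psi : CovectorField I M) (x : M) : Prop :=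
  ∀ e i j k l : TangentSpace I x,
    nablaRiem g x e i j k l = Pi x e * Riem g x i j k l
      + Psi x e * kulkarniNomizu (fun v w => g x v w) (Ricci g x) i j k l

/-- The set of points at which `∇R ≠ ξ ⊗ R` for every covector `ξ`. -/
def nonRecurrentSet (g : BilinField I M) : Set M :=
  {x | ¬ ∃ ξ : TangentSpace I x →L[ℝ] ℝ, ∀ e i j k l : TangentSpace I x,
    nablaRiem g x e i j k l = ξ e * Riem g x i j k l}

/-- `(M, g)` is hyper generalized recurrent with associated 1-forms `(Π, Ψ)`. -/
def IsHGK [FiniteDimensional ℝ E] (g : BilinField I M) (Pi Psi : CovectorField I M) : Prop :=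
  ∀ x ∈ nonRecurrentSet g, HGKEquationAt g Pi Psi x

end Manifold

/-! ### Warped products -/

section Warped

variable {E₁ : Type*} [NormedAddCommGroup E₁] [NormedSpace ℝ E₁]
  {H₁ : Type*} [TopologicalSpace H₁] {I₁ : ModelWithCorners ℝ E₁ H₁}
  {B : Type*} [TopologicalSpace B] [ChartedSpace H₁ B]
  {E₂ : Type*} [NormedAddCommGroup E₂] [NormedSpace ℝ E₂]
  {H₂ : Type*} [TopologicalSpace H₂] {I₂ : ModelWithCorners ℝ E₂ H₂}
  {F : Type*} [TopologicalSpace F] [ChartedSpace H₂ F]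

/-- The warped product metric `π^* g₁ + (f ∘ π) σ^* g₂` on `B × F`. -/
def warpedMetric (g₁ : BilinField I₁ B) (g₂ : BilinField I₂ F) (f : B → ℝ) :
    BilinField (I₁.prod I₂) (B × F) := fun x =>
  let dπ : E₁ × E₂ →L[ℝ] E₁ := mfderiv (I₁.prod I₂) I₁ Prod.fst x
  let dσ : E₁ × E₂ →L[ℝ] E₂ := mfderiv (I₁.prod I₂) I₂ Prod.snd x
  let A : E₁ →L[ℝ] E₁ →L[ℝ] ℝ := g₁ x.1
  let C : E₂ →L[ℝ] E₂ →L[ℝ] ℝ := g₂ x.2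
  (A.bilinearComp dπ dπ + f x.1 • C.bilinearComp dσ dσ : E₁ × E₂ →L[ℝ] E₁ × E₂ →L[ℝ] ℝ)

theorem warpedMetric_apply (g₁ : BilinField I₁ B) (g₂ : BilinField I₂ F) (f : B → ℝ) (x : B × F)
    (v w : TangentSpace (I₁.prod I₂) x) :
    warpedMetric g₁ g₂ f x v w =
      g₁ x.1 (mfderiv (I₁.prod I₂) I₁ Prod.fst x v) (mfderiv (I₁.prod I₂) I₁ Prod.fst x w)
        + f x.1 * g₂ x.2 (mfderiv (I₁.prod I₂) I₂ Prod.snd x v)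
            (mfderiv (I₁.prod I₂) I₂ Prod.snd x w) := rfl

/-- The base part of a covector field on `B × F`: the covector `e ↦ η (e, 0)`. -/
def basePart (η : CovectorField (I₁.prod I₂) (B × F)) (x : B × F) (e : TangentSpace I₁ x.1) : ℝ :=
  η x (show E₁ × E₂ from (e, 0))

/-- The fiber part of a covector field on `B × F`: the covector `ε ↦ η (0, ε)`. -/
def fiberPart (η : CovectorField (I₁.prod I₂) (B × F)) (x : B × F) (ε : TangentSpace I₂ x.2) : ℝ :=
  η x (show E₁ × E₂ from (0, ε))

/-- The system of tensor identities on base and fiber, at the point `x = (x.1, x.2)` of `B × F`.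
`g₁, R₁, S₁` belong to the base, `g₂, R₂, S₂` to the fiber, `m` is the dimension of the fiber;
Latin letters are vectors tangent to the base, Greek letters vectors tangent to the fiber. -/
structure HGKSystemAt [FiniteDimensional ℝ E₁] [FiniteDimensional ℝ E₂]
    (g₁ : BilinField I₁ B) (g₂ : BilinField I₂ F)
    (f : B → ℝ) (Pi Psi : CovectorField (I₁.prod I₂) (B × F)) (x : B × F) : Prop where
  /-- `∇R₁ = Π₁ ⊗ R₁ + Ψ₁ ⊗ g₁ ∧ S₁ - m Ψ₁ ⊗ g₁ ∧ T` -/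
  base_base : ∀ e a b c d : TangentSpace I₁ x.1,
    nablaRiem g₁ x.1 e a b c d =
      basePart Pi x e * Riem g₁ x.1 a b c d
      + basePart Psi x e * kulkarniNomizu (fun v w => g₁ x.1 v w) (Ricci g₁ x.1) a b c d
      - (Module.finrank ℝ E₂ : ℝ) * basePart Psi x e *
          kulkarniNomizu (fun v w => g₁ x.1 v w) (tensorT g₁ f x.1) a b c d
  /-- `-Π₂ ⊗ R₁ = Ψ₂ ⊗ g₁ ∧ S₁ - m Ψ₂ ⊗ g₁ ∧ T` -/
  base_fiber : ∀ (ε : TangentSpace I₂ x.2) (a b c d : TangentSpace I₁ x.1),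
    -(fiberPart Pi x ε * Riem g₁ x.1 a b c d) =
      fiberPart Psi x ε * kulkarniNomizu (fun v w => g₁ x.1 v w) (Ricci g₁ x.1) a b c d
      - (Module.finrank ℝ E₂ : ℝ) * fiberPart Psi x ε *
          kulkarniNomizu (fun v w => g₁ x.1 v w) (tensorT g₁ f x.1) a b c d
  /-- `-(df + f Π₁) ⊗ R₂ = f Ψ₁ ⊗ g₂ ∧ S₂ + (½ f² (P Π₁ - dP) + f Q Ψ₁) ⊗ g₂ ∧ g₂` -/
  fiber_base : ∀ (e : TangentSpace I₁ x.1) (α β γ δ : TangentSpace I₂ x.2),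
    -((dFun I₁ f x.1 e + f x.1 * basePart Pi x e) * Riem g₂ x.2 α β γ δ) =
      f x.1 * basePart Psi x e *
          kulkarniNomizu (fun v w => g₂ x.2 v w) (Ricci g₂ x.2) α β γ δ
      + (1 / 2 * f x.1 ^ 2 * (funP g₁ f x.1 * basePart Pi x e - dP g₁ f x.1 e)
          + f x.1 * funQ g₁ f (Module.finrank ℝ E₂) x.1 * basePart Psi x e) *
          kulkarniNomizu (fun v w => g₂ x.2 v w) (fun v w => g₂ x.2 v w) α β γ δ
  /-- `f ∇R₂ = f Π₂ ⊗ R₂ + f Ψ₂ ⊗ g₂ ∧ S₂ + (½ f² P Π₂ + f Q Ψ₂) ⊗ g₂ ∧ g₂` -/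
  fiber_fiber : ∀ ε α β γ δ : TangentSpace I₂ x.2,
    f x.1 * nablaRiem g₂ x.2 ε α β γ δ =
      f x.1 * fiberPart Pi x ε * Riem g₂ x.2 α β γ δ
      + f x.1 * fiberPart Psi x ε *
          kulkarniNomizu (fun v w => g₂ x.2 v w) (Ricci g₂ x.2) α β γ δ
      + (1 / 2 * f x.1 ^ 2 * funP g₁ f x.1 * fiberPart Pi x ε
          + f x.1 * funQ g₁ f (Module.finrank ℝ E₂) x.1 * fiberPart Psi x ε) *
          kulkarniNomizu (fun v w => g₂ x.2 v w) (fun v w => g₂ x.2 v w) α β γ δ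
  /-- `Ψ₁ ⊗ g₁ ⊗ S₂ = -[f (∇T - Π₁ ⊗ T) + f Ψ₁ ⊗ (S₁ - m T) + Q Ψ₁ ⊗ g₁] ⊗ g₂` -/
  mixed_base : ∀ (e a b : TangentSpace I₁ x.1) (α β : TangentSpace I₂ x.2),
    basePart Psi x e * g₁ x.1 a b * Ricci g₂ x.2 α β =
      -(f x.1 * (nablaT g₁ f x.1 e a b - basePart Pi x e * tensorT g₁ f x.1 a b)
        + f x.1 * basePart Psi x e *
            (Ricci g₁ x.1 a b - (Module.finrank ℝ E₂ : ℝ) * tensorT g₁ f x.1 a b)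
        + funQ g₁ f (Module.finrank ℝ E₂) x.1 * basePart Psi x e * g₁ x.1 a b) * g₂ x.2 α β
  /-- `Ψ₂ ⊗ g₁ ⊗ S₂ = -[-f Π₂ ⊗ T + f Ψ₂ ⊗ (S₁ - m T) + Q Ψ₂ ⊗ g₁] ⊗ g₂` -/
  mixed_fiber : ∀ (ε : TangentSpace I₂ x.2) (a b : TangentSpace I₁ x.1)
      (α β : TangentSpace I₂ x.2),
    fiberPart Psi x ε * g₁ x.1 a b * Ricci g₂ x.2 α β =
      -(-(f x.1 * fiberPart Pi x ε * tensorT g₁ f x.1 a b)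
        + f x.1 * fiberPart Psi x ε *
            (Ricci g₁ x.1 a b - (Module.finrank ℝ E₂ : ℝ) * tensorT g₁ f x.1 a b)
        + funQ g₁ f (Module.finrank ℝ E₂) x.1 * fiberPart Psi x ε * g₁ x.1 a b) * g₂ x.2 α β
  /-- `f^d R_{abcd} = -(f_a T_{bc} - f_b T_{ac})` on the base -/
  grad_curv : ∀ a b c : TangentSpace I₁ x.1,
    Riem g₁ x.1 a b c (gradFun g₁ f x.1) =
      -(dFun I₁ f x.1 a * tensorT g₁ f x.1 b c - dFun I₁ f x.1 b * tensorT g₁ f x.1 a c)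
  /-- `df ⊗ R₂ = f² dP ⊗ G₂` with `G₂ = ½ g₂ ∧ g₂` -/
  d_curv : ∀ (e : TangentSpace I₁ x.1) (α β γ δ : TangentSpace I₂ x.2),
    dFun I₁ f x.1 e * Riem g₂ x.2 α β γ δ =
      f x.1 ^ 2 * dP g₁ f x.1 e *
        (1 / 2 * kulkarniNomizu (fun v w => g₂ x.2 v w) (fun v w => g₂ x.2 v w) α β γ δ)

end Warped

end

open scoped Manifold ContDiff Bundle

noncomputable section

/-! The identity at a point involves only `g`, `R`, `∇R` and `S` there, so it can be checked in one
chart. The chart of `B × F` at a point is the product of charts of the factors, and in it the metric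
is the warped product of two local metrics. There everything is explicit.

The Christoffel symbols (`christoffel_warped`) couple the factors in two ways: a base term `-½
g₂(u,v) grad f`, and fiber terms in which `df / 2f` rescales or moves a fiber vector. Inserting them
gives `R = R₁ + f R₂ + f² P G₂ - f (T ∧ g₂)` (`riem_warped`) and `S = S₁ - m T + S₂ + Q g₂`
(`ricci_warped`), with `m` the fiber dimension and `G₂ = ½ g₂ ∧ g₂`. Differentiating `R` covariantly
(`nablaRiem_warped`) yields `∇R₁`, `f ∇R₂`, `-f (∇T ∧ g₂)`, and terms built from two defects,
`gradDefect` and `fiberDefect`, whose vanishing is exactly condition 4.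

Both sides of the identity are multilinear, so it splits according to which slots hold base vectors
and which hold fiber vectors. Up to the symmetries of curvature, eight types of slots are
nontrivial, and they are the eight conditions; conversely the full identity is a linear combination
of these (`hgk_iff`). The equivalence is pointwise, hence it holds over any set of points. -/

namespace LocalMetric

variable {E : Type*} [NormedAddCommGroup E] [NormedSpace ℝ E]

/-! ### Normed structures on spaces of linear, bilinear and trilinear forms -/

section Instances

variable {A C D : Type*} [NormedAddCommGroup A] [NormedSpace ℝ A] [NormedAddCommGroup C]
  [NormedSpace ℝ C] [NormedAddCommGroup D] [NormedSpace ℝ D]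

instance normedAddCommGroupDual : NormedAddCommGroup (A →L[ℝ] ℝ) :=
  ContinuousLinearMap.toNormedAddCommGroup

instance normedSpaceDual : NormedSpace ℝ (A →L[ℝ] ℝ) :=
  ContinuousLinearMap.toNormedSpace

instance normedAddCommGroupBilin : NormedAddCommGroup (A →L[ℝ] C →L[ℝ] ℝ) :=
  ContinuousLinearMap.toNormedAddCommGroup

instance normedSpaceBilin : NormedSpace ℝ (A →L[ℝ] C →L[ℝ] ℝ) :=
  ContinuousLinearMap.toNormedSpace

instance normedAddCommGroupTrilin : NormedAddCommGroup (A →L[ℝ] C →L[ℝ] D →L[ℝ] ℝ) :=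
  ContinuousLinearMap.toNormedAddCommGroup

instance normedSpaceTrilin : NormedSpace ℝ (A →L[ℝ] C →L[ℝ] D →L[ℝ] ℝ) :=
  ContinuousLinearMap.toNormedSpace

end Instances

/-- A smooth field of symmetric nondegenerate bilinear forms on an open set. -/
structure IsMetricOn (G : E → E →L[ℝ] E →L[ℝ] ℝ) (U : Set E) : Prop where
  isOpen : IsOpen U
  smooth : ContDiffOn ℝ ∞ G U
  symm : ∀ y ∈ U, ∀ u v, G y u v = G y v u
  invertible : ∀ y ∈ U, (G y).IsInvertible

/-- Product rule for a moving bilinear form at moving arguments. With constant `a` and `b` it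
identifies the derivative of a coefficient of `G` with the coefficient of the derivative. -/
theorem fderiv_bilin_apply {X A C : Type*} [NormedAddCommGroup X] [NormedSpace ℝ X]
    [NormedAddCommGroup A] [NormedSpace ℝ A] [NormedAddCommGroup C] [NormedSpace ℝ C]
    {G : X → A →L[ℝ] C →L[ℝ] ℝ} {a : X → A} {b : X → C} {y : X}
    (hG : DifferentiableAt ℝ G y) (ha : DifferentiableAt ℝ a y) (hb : DifferentiableAt ℝ b y)
    (v : X) :
    fderiv ℝ (fun z => G z (a z) (b z)) y v =
      fderiv ℝ G y v (a y) (b y) + G y (fderiv ℝ a y v) (b y) + G y (a y) (fderiv ℝ b y v) := by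
  have h := ((hG.hasFDerivAt.clm_apply ha.hasFDerivAt).clm_apply hb.hasFDerivAt).fderiv
  rw [h]
  simp
  ring

/-- Flipping is a linear isometry, hence smooth. This handles the term `-∂_w G_{uv}` of the
Christoffel symbols, where the free slot is the direction of differentiation. -/
theorem contDiffAt_flip_apply {X A C : Type*} [NormedAddCommGroup X] [NormedSpace ℝ X]
    [NormedAddCommGroup A] [NormedSpace ℝ A] [NormedAddCommGroup C] [NormedSpace ℝ C]
    {T : X → A →L[ℝ] C →L[ℝ] ℝ} {c : X → C} {y : X}
    (hT : ContDiffAt ℝ ∞ T y) (hc : ContDiffAt ℝ ∞ c y) :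
    ContDiffAt ℝ ∞ (fun z => (T z).flip (c z)) y := by
  have : ContDiffAt ℝ ∞ (fun z => (T z).flip) y :=
    (ContinuousLinearMap.flipₗᵢ ℝ A C ℝ).contDiff.contDiffAt.comp y hT
  exact this.clm_apply hc

theorem contDiffAt_flip_apply_trilin {X A C D : Type*} [NormedAddCommGroup X] [NormedSpace ℝ X]
    [NormedAddCommGroup A] [NormedSpace ℝ A] [NormedAddCommGroup C] [NormedSpace ℝ C]
    [NormedAddCommGroup D] [NormedSpace ℝ D]
    {T : X → A →L[ℝ] C →L[ℝ] D →L[ℝ] ℝ} {c : X → C} {y : X}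
    (hT : ContDiffAt ℝ ∞ T y) (hc : ContDiffAt ℝ ∞ c y) :
    ContDiffAt ℝ ∞ (fun z => (T z).flip (c z)) y := by
  have : ContDiffAt ℝ ∞ (fun z => (T z).flip) y :=
    (ContinuousLinearMap.flipₗᵢ ℝ A C (D →L[ℝ] ℝ)).contDiff.contDiffAt.comp y hT
  exact this.clm_apply hc

/-! ### Pointwise algebra of Christoffel symbols and curvature -/

section Algebraic

variable (G : E → E →L[ℝ] E →L[ℝ] ℝ) (y : E)

-- `ContinuousLinearMap.inverse (G y)` is a linear map even when `G y` is not invertible (it is then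
-- zero), so nondegeneracy plays no role.
@[simp] theorem sharp_add (φ ψ : E →L[ℝ] ℝ) : sharp G y (φ + ψ) = sharp G y φ + sharp G y ψ := by
  simp [sharp]

@[simp] theorem sharp_smul (c : ℝ) (φ : E →L[ℝ] ℝ) : sharp G y (c • φ) = c • sharp G y φ := by
  simp [sharp]

@[simp] theorem christoffel_add_left (u u' v : E) :
    christoffel G y (u + u') v = christoffel G y u v + christoffel G y u' v := by
  rw [christoffel, christoffel, christoffel, ← sharp_add]
  congr 1
  ext w
  simp [christoffelLower_apply]
  ring

@[simp] theorem christoffel_add_right (u v v' : E) :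
    christoffel G y u (v + v') = christoffel G y u v + christoffel G y u v' := by
  rw [christoffel, christoffel, christoffel, ← sharp_add]
  congr 1
  ext w
  simp [christoffelLower_apply]
  ring

@[simp] theorem christoffel_smul_left (c : ℝ) (u v : E) :
    christoffel G y (c • u) v = c • christoffel G y u v := by
  rw [christoffel, christoffel, ← sharp_smul]
  congr 1
  ext w
  simp [christoffelLower_apply]
  ring

@[simp] theorem christoffel_smul_right (c : ℝ) (u v : E) :
    christoffel G y u (c • v) = c • christoffel G y u v := by
  rw [christoffel, christoffel, ← sharp_smul]
  congr 1
  ext w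
  simp [christoffelLower_apply]
  ring

@[simp] theorem christoffel_zero_left (v : E) : christoffel G y 0 v = 0 := by
  simpa using christoffel_smul_left G y 0 0 v

@[simp] theorem christoffel_zero_right (u : E) : christoffel G y u 0 = 0 := by
  simpa using christoffel_smul_right G y 0 u 0

theorem curvOp_skew (i j k : E) : curvOp G y i j k = -curvOp G y j i k := by
  simp only [curvOp]
  abel

-- The vanishing rules from here on evaluate the warped product formulas on vectors tangent to a
-- single factor.
@[simp] theorem curvOp_zero_left (j k : E) : curvOp G y 0 j k = 0 := by
  simp [curvOp]

@[simp] theorem curvOp_zero_mid (j k : E) : curvOp G y j 0 k = 0 := by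
  simp [curvOp]

@[simp] theorem curvOp_zero_right (j k : E) : curvOp G y j k 0 = 0 := by
  simp [curvOp]

theorem riem_skew_left (i j k l : E) : riem G y i j k l = -riem G y j i k l := by
  simp [riem, curvOp_skew G y i j k]

@[simp] theorem riem_zero₁ (j k l : E) : riem G y 0 j k l = 0 := by simp [riem]
@[simp] theorem riem_zero₂ (i k l : E) : riem G y i 0 k l = 0 := by simp [riem]
@[simp] theorem riem_zero₃ (i j l : E) : riem G y i j 0 l = 0 := by simp [riem]
@[simp] theorem riem_zero₄ (i j k : E) : riem G y i j k 0 = 0 := by simp [riem]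

@[simp] theorem nablaRiem_zero (i j k l : E) : nablaRiem G y 0 i j k l = 0 := by
  simp [nablaRiem, covDeriv₄]
@[simp] theorem nablaRiem_zero₁ (e j k l : E) : nablaRiem G y e 0 j k l = 0 := by
  simp [nablaRiem, covDeriv₄]
@[simp] theorem nablaRiem_zero₃ (e i j l : E) : nablaRiem G y e i j 0 l = 0 := by
  simp [nablaRiem, covDeriv₄]
@[simp] theorem nablaRiem_zero₄ (e i j k : E) : nablaRiem G y e i j k 0 = 0 := by
  simp [nablaRiem, covDeriv₄]

@[simp] theorem ricci_zero_left [FiniteDimensional ℝ E] (k : E) : ricci G y 0 k = 0 := by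
  simp [ricci]
@[simp] theorem ricci_zero_right [FiniteDimensional ℝ E] (j : E) : ricci G y j 0 = 0 := by
  simp [ricci]

variable (f : E → ℝ)

@[simp] theorem hessian_zero_left (b : E) : hessian G f y 0 b = 0 := by simp [hessian]
@[simp] theorem hessian_zero_right (a : E) : hessian G f y a 0 = 0 := by simp [hessian]
@[simp] theorem warpT_zero_left (b : E) : warpT G f y 0 b = 0 := by simp [warpT]
@[simp] theorem warpT_zero_right (a : E) : warpT G f y a 0 = 0 := by simp [warpT]
@[simp] theorem nablaWarpT_zero (a b : E) : nablaWarpT G f y 0 a b = 0 := by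
  simp [nablaWarpT, covDeriv₂]
@[simp] theorem nablaWarpT_zero_left (e b : E) : nablaWarpT G f y e 0 b = 0 := by
  simp [nablaWarpT, covDeriv₂]
@[simp] theorem nablaWarpT_zero_right (e a : E) : nablaWarpT G f y e a 0 = 0 := by
  simp [nablaWarpT, covDeriv₂]

end Algebraic

namespace IsMetricOn

variable {G : E → E →L[ℝ] E →L[ℝ] ℝ} {U : Set E} {y : E}

/-! ### The Levi-Civita connection of a local metric -/

section Basic

theorem mem_nhds (h : IsMetricOn G U) (hy : y ∈ U) : U ∈ nhds y := h.isOpen.mem_nhds hy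

theorem contDiffAt (h : IsMetricOn G U) (hy : y ∈ U) : ContDiffAt ℝ ∞ G y :=
  h.smooth.contDiffAt (h.mem_nhds hy)

theorem differentiableAt (h : IsMetricOn G U) (hy : y ∈ U) : DifferentiableAt ℝ G y :=
  (h.contDiffAt hy).differentiableAt (by simp)

theorem apply_sharp (h : IsMetricOn G U) (hy : y ∈ U) (φ : E →L[ℝ] ℝ) :
    G y (sharp G y φ) = φ := by
  obtain ⟨e, he⟩ := h.invertible y hy
  simp [sharp, ← he]

theorem ext (h : IsMetricOn G U) (hy : y ∈ U) {u v : E} (huv : ∀ w, G y u w = G y v w) :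
    u = v := by
  obtain ⟨e, he⟩ := h.invertible y hy
  apply e.injective
  ext w
  have := huv w
  rw [← he] at this
  exact this

/-- Lowering the index removes the inverse metric. Identities between vectors are proved in this
form and then raised again by nondegeneracy (`ext`). -/
theorem apply_christoffel (h : IsMetricOn G U) (hy : y ∈ U) (u v w : E) :
    G y (christoffel G y u v) w =
      1 / 2 * (fderiv ℝ G y u v w + fderiv ℝ G y v u w - fderiv ℝ G y w u v) := by
  rw [christoffel, h.apply_sharp hy, christoffelLower_apply]

theorem fderiv_symm (h : IsMetricOn G U) (hy : y ∈ U) (u v w : E) :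
    fderiv ℝ G y u v w = fderiv ℝ G y u w v := by
  have h1 : (fun z => G z v w) =ᶠ[nhds y] fun z => G z w v := by
    filter_upwards [h.mem_nhds hy] with z hz using h.symm z hz v w
  have h2 := congrArg (fun L : E →L[ℝ] ℝ => L u) h1.fderiv_eq
  simpa [fderiv_bilin_apply (h.differentiableAt hy)] using h2

theorem christoffel_comm (h : IsMetricOn G U) (hy : y ∈ U) (u v : E) :
    christoffel G y u v = christoffel G y v u := by
  refine h.ext hy fun w => ?_
  rw [h.apply_christoffel hy, h.apply_christoffel hy, h.fderiv_symm hy w u v]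
  ring

/-- The Levi-Civita connection is metric. -/
theorem fderiv_eq (h : IsMetricOn G U) (hy : y ∈ U) (u v w : E) :
    fderiv ℝ G y u v w = G y (christoffel G y u v) w + G y v (christoffel G y u w) := by
  rw [h.symm y hy v, h.apply_christoffel hy, h.apply_christoffel hy, h.fderiv_symm hy u v w,
    h.fderiv_symm hy v u w, h.fderiv_symm hy w u v]
  ring

end Basic

/-! ### Smoothness, tensoriality and symmetries of the curvature -/

section Smooth

variable [CompleteSpace E]

/-- Operator inversion is smooth at an invertible operator on a complete space. -/
theorem contDiffAt_sharp (h : IsMetricOn G U) (hy : y ∈ U) {φ : E → E →L[ℝ] ℝ}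
    (hφ : ContDiffAt ℝ ∞ φ y) : ContDiffAt ℝ ∞ (fun z => sharp G z (φ z)) y := by
  obtain ⟨e, he⟩ := h.invertible y hy
  have h1 : ContDiffAt ℝ ∞ (ContinuousLinearMap.inverse : (E →L[ℝ] E →L[ℝ] ℝ) → _) (G y) := by
    rw [← he]
    exact contDiffAt_map_inverse e
  exact (h1.comp y (h.contDiffAt hy)).clm_apply hφ

theorem contDiffAt_fderiv (h : IsMetricOn G U) (hy : y ∈ U) : ContDiffAt ℝ ∞ (fderiv ℝ G) y :=
  (h.contDiffAt hy).fderiv_right (by simp)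

theorem contDiffAt_christoffel (h : IsMetricOn G U) (hy : y ∈ U) {a b : E → E}
    (ha : ContDiffAt ℝ ∞ a y) (hb : ContDiffAt ℝ ∞ b y) :
    ContDiffAt ℝ ∞ (fun z => christoffel G z (a z) (b z)) y := by
  refine h.contDiffAt_sharp hy ?_
  have hD := h.contDiffAt_fderiv hy
  have h1 : ContDiffAt ℝ ∞ (fun z => fderiv ℝ G z (a z) (b z)) y :=
    (hD.clm_apply ha).clm_apply hb
  have h2 : ContDiffAt ℝ ∞ (fun z => fderiv ℝ G z (b z) (a z)) y :=
    (hD.clm_apply hb).clm_apply ha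
  have h3 : ContDiffAt ℝ ∞ (fun z => ((fderiv ℝ G z).flip (a z)).flip (b z)) y :=
    contDiffAt_flip_apply (contDiffAt_flip_apply_trilin hD ha) hb
  exact ((h1.add h2).sub h3).const_smul (1 / 2 : ℝ)

theorem differentiableAt_christoffel (h : IsMetricOn G U) (hy : y ∈ U) (u v : E) :
    DifferentiableAt ℝ (fun z => christoffel G z u v) y :=
  (h.contDiffAt_christoffel hy contDiffAt_const contDiffAt_const).differentiableAt (by simp)

theorem contDiffAt_curvOp (h : IsMetricOn G U) (hy : y ∈ U) (u v w : E) :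
    ContDiffAt ℝ ∞ (fun z => curvOp G z u v w) y := by
  have hc : ∀ u v : E, ContDiffAt ℝ ∞ (fun z => christoffel G z u v) y := fun u v =>
    h.contDiffAt_christoffel hy contDiffAt_const contDiffAt_const
  have hd : ∀ u v w : E, ContDiffAt ℝ ∞ (fun z => fderiv ℝ (fun z => christoffel G z u w) z v) y :=
    fun u v w => ((hc u w).fderiv_right (by simp)).clm_apply contDiffAt_const
  exact (((hd u v w).sub (hd v u w)).add (h.contDiffAt_christoffel hy contDiffAt_const (hc u w))).sub
    (h.contDiffAt_christoffel hy contDiffAt_const (hc v w))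

theorem contDiffAt_riem (h : IsMetricOn G U) (hy : y ∈ U) (i j k l : E) :
    ContDiffAt ℝ ∞ (fun z => riem G z i j k l) y :=
  ((h.contDiffAt hy).clm_apply (h.contDiffAt_curvOp hy i j k)).clm_apply contDiffAt_const

theorem differentiableAt_riem (h : IsMetricOn G U) (hy : y ∈ U) (i j k l : E) :
    DifferentiableAt ℝ (fun z => riem G z i j k l) y :=
  (h.contDiffAt_riem hy i j k l).differentiableAt (by simp)

theorem fderiv_christoffel_add_left (h : IsMetricOn G U) (hy : y ∈ U) (u u' v w : E) :
    fderiv ℝ (fun z => christoffel G z (u + u') v) y w =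
      fderiv ℝ (fun z => christoffel G z u v) y w
        + fderiv ℝ (fun z => christoffel G z u' v) y w := by
  simp_rw [christoffel_add_left]
  rw [fderiv_fun_add (h.differentiableAt_christoffel hy _ _)
    (h.differentiableAt_christoffel hy _ _)]
  rfl

theorem fderiv_christoffel_add_right (h : IsMetricOn G U) (hy : y ∈ U) (u v v' w : E) :
    fderiv ℝ (fun z => christoffel G z u (v + v')) y w =
      fderiv ℝ (fun z => christoffel G z u v) y w
        + fderiv ℝ (fun z => christoffel G z u v') y w := by
  simp_rw [christoffel_add_right]
  rw [fderiv_fun_add (h.differentiableAt_christoffel hy _ _)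
    (h.differentiableAt_christoffel hy _ _)]
  rfl

theorem fderiv_christoffel_smul_left (h : IsMetricOn G U) (hy : y ∈ U) (c : ℝ) (u v w : E) :
    fderiv ℝ (fun z => christoffel G z (c • u) v) y w =
      c • fderiv ℝ (fun z => christoffel G z u v) y w := by
  simp_rw [christoffel_smul_left]
  rw [fderiv_fun_const_smul (h.differentiableAt_christoffel hy _ _)]
  rfl

theorem fderiv_christoffel_smul_right (h : IsMetricOn G U) (hy : y ∈ U) (c : ℝ) (u v w : E) :
    fderiv ℝ (fun z => christoffel G z u (c • v)) y w =
      c • fderiv ℝ (fun z => christoffel G z u v) y w := by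
  simp_rw [christoffel_smul_right]
  rw [fderiv_fun_const_smul (h.differentiableAt_christoffel hy _ _)]
  rfl

theorem curvOp_add_left (h : IsMetricOn G U) (hy : y ∈ U) (u u' v w : E) :
    curvOp G y (u + u') v w = curvOp G y u v w + curvOp G y u' v w := by
  simp only [curvOp]
  simp only [h.fderiv_christoffel_add_left hy]
  simp only [map_add, christoffel_add_left,
    christoffel_add_right]
  abel

theorem curvOp_smul_left (h : IsMetricOn G U) (hy : y ∈ U) (c : ℝ) (u v w : E) :
    curvOp G y (c • u) v w = c • curvOp G y u v w := by
  simp only [curvOp]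
  simp only [h.fderiv_christoffel_smul_left hy]
  simp only [map_smul, christoffel_smul_left,
    christoffel_smul_right, smul_add, smul_sub]

theorem curvOp_add_right (h : IsMetricOn G U) (hy : y ∈ U) (u v w w' : E) :
    curvOp G y u v (w + w') = curvOp G y u v w + curvOp G y u v w' := by
  simp only [curvOp]
  simp only [h.fderiv_christoffel_add_right hy]
  simp only [christoffel_add_right]
  abel

theorem curvOp_smul_right (h : IsMetricOn G U) (hy : y ∈ U) (c : ℝ) (u v w : E) :
    curvOp G y u v (c • w) = c • curvOp G y u v w := by
  simp only [curvOp]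
  simp only [h.fderiv_christoffel_smul_right hy]
  simp only [christoffel_smul_right, smul_add, smul_sub]

theorem riem_add₁ (h : IsMetricOn G U) (hy : y ∈ U) (i i' j k l : E) :
    riem G y (i + i') j k l = riem G y i j k l + riem G y i' j k l := by
  simp [riem, h.curvOp_add_left hy]

theorem riem_smul₁ (h : IsMetricOn G U) (hy : y ∈ U) (c : ℝ) (i j k l : E) :
    riem G y (c • i) j k l = c * riem G y i j k l := by
  simp [riem, h.curvOp_smul_left hy]

theorem riem_add₂ (h : IsMetricOn G U) (hy : y ∈ U) (i j j' k l : E) :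
    riem G y i (j + j') k l = riem G y i j k l + riem G y i j' k l := by
  rw [riem_skew_left, h.riem_add₁ hy, riem_skew_left G y i j, riem_skew_left G y i j']
  ring

theorem riem_smul₂ (h : IsMetricOn G U) (hy : y ∈ U) (c : ℝ) (i j k l : E) :
    riem G y i (c • j) k l = c * riem G y i j k l := by
  rw [riem_skew_left, h.riem_smul₁ hy, riem_skew_left G y i j]
  ring

theorem riem_add₃ (h : IsMetricOn G U) (hy : y ∈ U) (i j k k' l : E) :
    riem G y i j (k + k') l = riem G y i j k l + riem G y i j k' l := by
  simp [riem, h.curvOp_add_right hy]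

theorem riem_smul₃ (h : IsMetricOn G U) (hy : y ∈ U) (c : ℝ) (i j k l : E) :
    riem G y i j (c • k) l = c * riem G y i j k l := by
  simp [riem, h.curvOp_smul_right hy]

theorem riem_add₄ (_h : IsMetricOn G U) (_hy : y ∈ U) (i j k l l' : E) :
    riem G y i j k (l + l') = riem G y i j k l + riem G y i j k l' := by
  simp [riem]

theorem riem_smul₄ (_h : IsMetricOn G U) (_hy : y ∈ U) (c : ℝ) (i j k l : E) :
    riem G y i j k (c • l) = c * riem G y i j k l := by
  simp [riem]

theorem fderiv_fderiv_apply (h : IsMetricOn G U) (hy : y ∈ U) (u v a b : E) :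
    fderiv ℝ (fun z => fderiv ℝ G z v a b) y u = fderiv ℝ (fderiv ℝ G) y u v a b := by
  have hD : DifferentiableAt ℝ (fderiv ℝ G) y :=
    (h.contDiffAt_fderiv hy).differentiableAt (by simp)
  rw [fderiv_bilin_apply (G := fun z => fderiv ℝ G z v) (a := fun _ => a) (b := fun _ => b)
    (by fun_prop) (by fun_prop) (by fun_prop),
    (hD.hasFDerivAt.clm_apply (hasFDerivAt_const v y)).fderiv]
  simp

theorem differentiableAt_fderiv_apply (h : IsMetricOn G U) (hy : y ∈ U) (v a b : E) :
    DifferentiableAt ℝ (fun z => fderiv ℝ G z v a b) y := by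
  have hD : DifferentiableAt ℝ (fderiv ℝ G) y :=
    (h.contDiffAt_fderiv hy).differentiableAt (by simp)
  fun_prop

/-- The derivative of the Christoffel symbols, lowered. -/
theorem apply_fderiv_christoffel (h : IsMetricOn G U) (hy : y ∈ U) (u v w l : E) :
    G y (fderiv ℝ (fun z => christoffel G z u w) y v) l =
      1 / 2 * (fderiv ℝ (fderiv ℝ G) y v u w l + fderiv ℝ (fderiv ℝ G) y v w u l
        - fderiv ℝ (fderiv ℝ G) y v l u w)
      - G y (christoffel G y v (christoffel G y u w)) l
      - G y (christoffel G y u w) (christoffel G y v l) := by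
  have hD : DifferentiableAt ℝ (fderiv ℝ G) y :=
    (h.contDiffAt_fderiv hy).differentiableAt (by simp)
  have hE : ∀ a b c : E, DifferentiableAt ℝ (fun z => fderiv ℝ G z a b c) y := fun a b c => by
    fun_prop
  -- Differentiating the lowered identity avoids differentiating the inverse metric; the derivative
  -- of `G` itself is rewritten by metric compatibility.
  have h1 : (fun z => G z (christoffel G z u w) l) =ᶠ[nhds y] fun z =>
      1 / 2 * (fderiv ℝ G z u w l + fderiv ℝ G z w u l - fderiv ℝ G z l u w) := by
    filter_upwards [h.mem_nhds hy] with z hz using h.apply_christoffel hz u w l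
  have h2 := congrArg (fun L : E →L[ℝ] ℝ => L v) h1.fderiv_eq
  beta_reduce at h2
  rw [fderiv_bilin_apply (h.differentiableAt hy) (h.differentiableAt_christoffel hy _ _)
    (by fun_prop), fderiv_const_mul (by fun_prop), fderiv_fun_sub (by fun_prop) (by fun_prop),
    fderiv_fun_add (by fun_prop) (by fun_prop)] at h2
  simp only [fderiv_fun_const, Pi.zero_apply, smul_eq_mul, FunLike.coe_smul,
    FunLike.coe_sub, FunLike.coe_add, Pi.smul_apply, Pi.sub_apply,
    Pi.add_apply, h.fderiv_fderiv_apply hy, zero_apply, map_zero, h.fderiv_eq hy] at h2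
  linarith

theorem second_fderiv_comm (h : IsMetricOn G U) (hy : y ∈ U) (u v : E) :
    fderiv ℝ (fderiv ℝ G) y u v = fderiv ℝ (fderiv ℝ G) y v u :=
  ((h.contDiffAt hy).isSymmSndFDerivAt (by simpa using ENat.LEInfty.out)) u v

theorem second_fderiv_symm (h : IsMetricOn G U) (hy : y ∈ U) (u v a b : E) :
    fderiv ℝ (fderiv ℝ G) y u v a b = fderiv ℝ (fderiv ℝ G) y u v b a := by
  rw [← h.fderiv_fderiv_apply hy, ← h.fderiv_fderiv_apply hy]
  have h1 : (fun z => fderiv ℝ G z v a b) =ᶠ[nhds y] fun z => fderiv ℝ G z v b a := by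
    filter_upwards [h.mem_nhds hy] with z hz using h.fderiv_symm hz v a b
  rw [h1.fderiv_eq]

/-- After lowering, the iterated terms `G(Γ(v, Γ(u,w)), l)` cancel against those in
`apply_fderiv_christoffel`. What remains is second derivatives of `G` and pairings of two
Christoffel vectors, from which the curvature symmetries can be read off and into which a warped
product is easily substituted. -/
theorem riem_eq (h : IsMetricOn G U) (hy : y ∈ U) (i j k l : E) :
    riem G y i j k l =
      1 / 2 * (fderiv ℝ (fderiv ℝ G) y j k i l - fderiv ℝ (fderiv ℝ G) y j l i k
        - fderiv ℝ (fderiv ℝ G) y i k j l + fderiv ℝ (fderiv ℝ G) y i l j k)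
      - G y (christoffel G y i k) (christoffel G y j l)
      + G y (christoffel G y j k) (christoffel G y i l) := by
  simp only [riem, curvOp, map_add, map_sub, add_apply,
    sub_apply, h.apply_fderiv_christoffel hy]
  rw [h.second_fderiv_comm hy j i]
  ring

theorem riem_skew_right (h : IsMetricOn G U) (hy : y ∈ U) (i j k l : E) :
    riem G y i j k l = -riem G y i j l k := by
  rw [h.riem_eq hy, h.riem_eq hy, h.symm y hy (christoffel G y i k),
    h.symm y hy (christoffel G y j k)]
  ring

theorem riem_pair_symm (h : IsMetricOn G U) (hy : y ∈ U) (i j k l : E) :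
    riem G y i j k l = riem G y k l i j := by
  rw [h.riem_eq hy, h.riem_eq hy, h.second_fderiv_comm hy l i, h.second_fderiv_comm hy l j,
    h.second_fderiv_comm hy k i, h.second_fderiv_comm hy k j, h.second_fderiv_symm hy i k l j,
    h.second_fderiv_symm hy j k l i, h.second_fderiv_symm hy j l k i,
    h.second_fderiv_symm hy i l k j,
    h.christoffel_comm hy i k, h.christoffel_comm hy j l,
    h.christoffel_comm hy j k, h.christoffel_comm hy i l,
    h.symm y hy (christoffel G y k j)]
  ring

/-- The Ricci tensor is the trace of a linear endomorphism, so any basis computes it. This permits a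
basis adapted to a product. -/
theorem ricci_eq_sum [FiniteDimensional ℝ E] (h : IsMetricOn G U) (hy : y ∈ U)
    {ι : Type*} [Fintype ι] (b : Module.Basis ι ℝ E) (j k : E) :
    ricci G y j k = ∑ i, b.coord i (curvOp G y (b i) j k) := by
  classical
  let L : E →ₗ[ℝ] E :=
    { toFun := fun u => curvOp G y u j k
      map_add' := fun u v => h.curvOp_add_left hy u v j k
      map_smul' := fun c u => h.curvOp_smul_left hy c u j k }
  have key : ∀ {κ : Type _} [Fintype κ] [DecidableEq κ] (c : Module.Basis κ ℝ E),
      LinearMap.trace ℝ E L = ∑ i, c.coord i (L (c i)) := by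
    intro κ _ _ c
    rw [LinearMap.trace_eq_matrix_trace ℝ c, Matrix.trace]
    simp [LinearMap.toMatrix_apply]
  have h1 := key (Module.finBasis ℝ E)
  have h2 : LinearMap.trace ℝ E L = ∑ i, b.coord i (L (b i)) := by
    rw [LinearMap.trace_eq_matrix_trace ℝ b, Matrix.trace]
    simp [LinearMap.toMatrix_apply]
  exact h1.symm.trans h2

end Smooth

end IsMetricOn

section FiniteDimensional

variable {E : Type*} [NormedAddCommGroup E] [NormedSpace ℝ E] [FiniteDimensional ℝ E]

/-- An injective map from `E` to its dual is bijective because the dimensions agree. -/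
theorem isInvertible_of_nondegenerate {A : E →L[ℝ] E →L[ℝ] ℝ}
    (hA : ∀ v, (∀ w, A v w = 0) → v = 0) : A.IsInvertible := by
  have hinj : Function.Injective A := by
    rw [injective_iff_map_eq_zero]
    intro v hv
    exact hA v fun w => by rw [hv]; rfl
  have hdim : Module.finrank ℝ E = Module.finrank ℝ (E →L[ℝ] ℝ) := by
    rw [← (LinearMap.toContinuousLinearMap (𝕜 := ℝ) (E := E) (F' := ℝ)).finrank_eq]
    exact (Subspace.dual_finrank_eq (K := ℝ) (V := E)).symm
  let e := LinearEquiv.ofInjectiveOfFinrankEq (A : E →ₗ[ℝ] E →L[ℝ] ℝ) hinj hdim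
  exact ⟨e.toContinuousLinearEquiv, by ext; rfl⟩

theorem contDiffOn_bilin_of_apply {X : Type*} [NormedAddCommGroup X] [NormedSpace ℝ X]
    {G : X → E →L[ℝ] E →L[ℝ] ℝ} {s : Set X}
    (h : ∀ u v, ContDiffOn ℝ ∞ (fun z => G z u v) s) : ContDiffOn ℝ ∞ G s :=
  contDiffOn_clm_apply.2 fun u => contDiffOn_clm_apply.2 fun v => h u v

end FiniteDimensional

/-! ### The tensor `T` and the function `P` -/

section Base

variable {E : Type*} [NormedAddCommGroup E] [NormedSpace ℝ E]
  {G : E → E →L[ℝ] E →L[ℝ] ℝ} {U : Set E} {f : E → ℝ} {y : E}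

theorem fderiv_fderiv_apply (hf : ContDiffAt ℝ ∞ f y) (a b : E) :
    fderiv ℝ (fun z => fderiv ℝ f z a) y b = fderiv ℝ (fderiv ℝ f) y b a := by
  have hD : DifferentiableAt ℝ (fderiv ℝ f) y :=
    (hf.fderiv_right (m := ∞) (by simp)).differentiableAt (by simp)
  rw [(hD.hasFDerivAt.clm_apply (hasFDerivAt_const a y)).fderiv]
  simp

theorem fderiv_fderiv_comm (hf : ContDiffAt ℝ ∞ f y) (a b : E) :
    fderiv ℝ (fderiv ℝ f) y a b = fderiv ℝ (fderiv ℝ f) y b a :=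
  (hf.isSymmSndFDerivAt (by simpa using ENat.LEInfty.out)) a b

theorem hessian_eq (hf : ContDiffAt ℝ ∞ f y) (a b : E) :
    hessian G f y a b = fderiv ℝ (fderiv ℝ f) y b a - fderiv ℝ f y (christoffel G y b a) := by
  rw [hessian, fderiv_fderiv_apply hf]

theorem warpT_eq (hf : ContDiffAt ℝ ∞ f y) (a b : E) :
    warpT G f y a b = -(1 / (2 * f y)) * (fderiv ℝ (fderiv ℝ f) y b a
      - fderiv ℝ f y (christoffel G y b a)
      - 1 / (2 * f y) * (fderiv ℝ f y a * fderiv ℝ f y b)) := by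
  rw [warpT, hessian_eq hf]

theorem warpT_add_left (hf : ContDiffAt ℝ ∞ f y) (a a' b : E) :
    warpT G f y (a + a') b = warpT G f y a b + warpT G f y a' b := by
  simp only [warpT_eq hf, map_add, christoffel_add_right]
  ring

theorem warpT_smul_left (hf : ContDiffAt ℝ ∞ f y) (c : ℝ) (a b : E) :
    warpT G f y (c • a) b = c * warpT G f y a b := by
  simp only [warpT_eq hf, map_smul, christoffel_smul_right, smul_eq_mul]
  ring

theorem fderiv_grad (hf0 : f y ≠ 0) :
    fderiv ℝ f y (grad G f y) = 4 * f y ^ 2 * warpP G f y := by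
  rw [warpP]
  field_simp

namespace IsMetricOn

/-- Second derivatives commute and the connection is torsion-free, so the Hessian is symmetric. -/
theorem warpT_comm (h : IsMetricOn G U) (hy : y ∈ U) (hf : ContDiffAt ℝ ∞ f y) (a b : E) :
    warpT G f y a b = warpT G f y b a := by
  rw [warpT_eq hf, warpT_eq hf, h.christoffel_comm hy b a, fderiv_fderiv_comm hf b a]
  ring

theorem warpT_add_right (h : IsMetricOn G U) (hy : y ∈ U) (hf : ContDiffAt ℝ ∞ f y) (a b b' : E) :
    warpT G f y a (b + b') = warpT G f y a b + warpT G f y a b' := by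
  simp only [h.warpT_comm hy hf a, warpT_add_left hf]

theorem warpT_smul_right (h : IsMetricOn G U) (hy : y ∈ U) (hf : ContDiffAt ℝ ∞ f y) (c : ℝ)
    (a b : E) : warpT G f y a (c • b) = c * warpT G f y a b := by
  simp only [h.warpT_comm hy hf a, warpT_smul_left hf]

theorem apply_grad (h : IsMetricOn G U) (hy : y ∈ U) (v : E) :
    G y (grad G f y) v = fderiv ℝ f y v := by
  rw [grad, h.apply_sharp hy]

theorem apply_grad_right (h : IsMetricOn G U) (hy : y ∈ U) (v : E) :
    G y v (grad G f y) = fderiv ℝ f y v := by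
  rw [h.symm y hy, h.apply_grad hy]

variable [CompleteSpace E]

theorem contDiffAt_grad (h : IsMetricOn G U) (hy : y ∈ U) (hf : ContDiffAt ℝ ∞ f y) :
    ContDiffAt ℝ ∞ (grad G f) y :=
  h.contDiffAt_sharp hy (hf.fderiv_right (by simp))

theorem contDiffAt_warpT (h : IsMetricOn G U) (hy : y ∈ U) (hf : ContDiffAt ℝ ∞ f y)
    (hf0 : f y ≠ 0) (a b : E) : ContDiffAt ℝ ∞ (fun z => warpT G f z a b) y := by
  have h1 : ∀ c : E, ContDiffAt ℝ ∞ (fun z => fderiv ℝ f z c) y := fun c =>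
    (hf.fderiv_right (by simp)).clm_apply contDiffAt_const
  have h2 : ContDiffAt ℝ ∞ (fun z => fderiv ℝ (fun z => fderiv ℝ f z a) z b) y :=
    ((h1 a).fderiv_right (by simp)).clm_apply contDiffAt_const
  have h3 : ContDiffAt ℝ ∞ (fun z => fderiv ℝ f z (christoffel G z b a)) y :=
    (hf.fderiv_right (by simp)).clm_apply
      (h.contDiffAt_christoffel hy contDiffAt_const contDiffAt_const)
  have h4 : ContDiffAt ℝ ∞ (fun z => 1 / (2 * f z)) y :=
    contDiffAt_const.div (contDiffAt_const.mul hf) (by simpa using hf0)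
  exact h4.neg.mul ((h2.sub h3).sub (h4.mul ((h1 a).mul (h1 b))))

theorem contDiffAt_warpP (h : IsMetricOn G U) (hy : y ∈ U) (hf : ContDiffAt ℝ ∞ f y)
    (hf0 : f y ≠ 0) : ContDiffAt ℝ ∞ (warpP G f) y := by
  have h1 : ContDiffAt ℝ ∞ (fun z => fderiv ℝ f z (grad G f z)) y :=
    (hf.fderiv_right (by simp)).clm_apply (h.contDiffAt_grad hy hf)
  have h4 : ContDiffAt ℝ ∞ (fun z => 1 / (4 * f z ^ 2)) y :=
    contDiffAt_const.div (contDiffAt_const.mul (hf.pow 2)) (by simpa using hf0)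
  exact h4.mul h1

/-- The derivative of the gradient is the Hessian, up to Christoffel symbols. -/
theorem apply_fderiv_grad (h : IsMetricOn G U) (hy : y ∈ U) (hf : ContDiffAt ℝ ∞ f y) (v l : E) :
    G y (fderiv ℝ (grad G f) y v) l = hessian G f y l v
      - G y (christoffel G y v (grad G f y)) l := by
  have h1 : (fun z => G z (grad G f z) l) =ᶠ[nhds y] fun z => fderiv ℝ f z l := by
    filter_upwards [h.mem_nhds hy] with z hz using h.apply_grad hz l
  have h2 := congrArg (fun L : E →L[ℝ] ℝ => L v) h1.fderiv_eq
  beta_reduce at h2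
  rw [fderiv_bilin_apply (h.differentiableAt hy)
    ((h.contDiffAt_grad hy hf).differentiableAt (by simp)) (by fun_prop), h.fderiv_eq hy] at h2
  simp only [fderiv_fun_const, Pi.zero_apply, zero_apply, map_zero,
    h.apply_grad hy] at h2
  rw [hessian]
  linarith

/-- Differentiating `|grad f|² = 4 f² P` expresses the Hessian on the gradient through `dP` and `P
df`. This is how `dP` enters the formula for `∇R`. -/
theorem warpT_grad (h : IsMetricOn G U) (hy : y ∈ U) (hf : ContDiffAt ℝ ∞ f y)
    (hf0 : f y ≠ 0) (a : E) :
    warpT G f y a (grad G f y) = -(fderiv ℝ f y a * warpP G f y)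
      - f y * fderiv ℝ (warpP G f) y a := by
  have hfd : DifferentiableAt ℝ f y := hf.differentiableAt (by simp)
  have h1 : (fun z => fderiv ℝ f z (grad G f z)) =ᶠ[nhds y]
      fun z => 4 * (f z * f z) * warpP G f z := by
    filter_upwards [h.mem_nhds hy, hf.continuousAt.eventually_ne hf0] with z hz hz0
    rw [fderiv_grad hz0]
    ring
  have h2 := congrArg (fun L : E →L[ℝ] ℝ => L a) h1.fderiv_eq
  beta_reduce at h2
  have hD : DifferentiableAt ℝ (fderiv ℝ f) y :=
    (hf.fderiv_right (m := ∞) (by simp)).differentiableAt (by simp)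
  have hg : DifferentiableAt ℝ (grad G f) y :=
    (h.contDiffAt_grad hy hf).differentiableAt (by simp)
  have hP : DifferentiableAt ℝ (warpP G f) y :=
    (h.contDiffAt_warpP hy hf hf0).differentiableAt (by simp)
  have h0 : HasFDerivAt (fun z => 4 * (f z * f z) * warpP G f z) _ y :=
    ((hfd.hasFDerivAt.mul hfd.hasFDerivAt).const_mul 4).mul hP.hasFDerivAt
  rw [(hD.hasFDerivAt.clm_apply hg.hasFDerivAt).fderiv, h0.fderiv] at h2
  simp at h2
  have h3 := h.apply_fderiv_grad hy hf a (grad G f y)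
  rw [h.apply_grad_right hy, h.apply_grad_right hy] at h3
  have h4 := hessian_eq (G := G) hf (grad G f y) a
  rw [h.warpT_comm hy hf, warpT, fderiv_grad hf0]
  have h5 : 2 * hessian G f y (grad G f y) a = 4 * (f y * f y) * fderiv ℝ (warpP G f) y a
      + 8 * f y * warpP G f y * fderiv ℝ f y a := by
    linarith
  have h6 : hessian G f y (grad G f y) a = 2 * (f y * f y) * fderiv ℝ (warpP G f) y a
      + 4 * f y * warpP G f y * fderiv ℝ f y a := by
    linarith
  rw [h6]
  field_simp
  ring

end IsMetricOn

end Base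

/-! ### Connection and curvature of a warped product of local metrics -/

section Warped

variable {E₁ : Type*} [NormedAddCommGroup E₁] [NormedSpace ℝ E₁]
  {E₂ : Type*} [NormedAddCommGroup E₂] [NormedSpace ℝ E₂]

/-- The warped product of two local metrics. -/
def warped (G₁ : E₁ → E₁ →L[ℝ] E₁ →L[ℝ] ℝ) (G₂ : E₂ → E₂ →L[ℝ] E₂ →L[ℝ] ℝ) (f : E₁ → ℝ)
    (y : E₁ × E₂) : E₁ × E₂ →L[ℝ] E₁ × E₂ →L[ℝ] ℝ :=
  (G₁ y.1).bilinearComp (ContinuousLinearMap.fst ℝ E₁ E₂) (ContinuousLinearMap.fst ℝ E₁ E₂)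
    + f y.1 • (G₂ y.2).bilinearComp (ContinuousLinearMap.snd ℝ E₁ E₂)
      (ContinuousLinearMap.snd ℝ E₁ E₂)

variable {G₁ : E₁ → E₁ →L[ℝ] E₁ →L[ℝ] ℝ} {G₂ : E₂ → E₂ →L[ℝ] E₂ →L[ℝ] ℝ} {f : E₁ → ℝ}
  {U₁ : Set E₁} {U₂ : Set E₂} {y : E₁ × E₂}

theorem warped_apply (y u v : E₁ × E₂) :
    warped G₁ G₂ f y u v = G₁ y.1 u.1 v.1 + f y.1 * G₂ y.2 u.2 v.2 := rfl

/-- The coefficients of the warped metric and of its curvature are sums of products of a base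
function and a fiber function, so this rule and `fderiv_comp_fst_apply` suffice to differentiate
them. -/
theorem fderiv_fst_mul_snd {a : E₁ → ℝ} {b : E₂ → ℝ} (ha : DifferentiableAt ℝ a y.1)
    (hb : DifferentiableAt ℝ b y.2) (v : E₁ × E₂) :
    fderiv ℝ (fun z : E₁ × E₂ => a z.1 * b z.2) y v =
      fderiv ℝ a y.1 v.1 * b y.2 + a y.1 * fderiv ℝ b y.2 v.2 := by
  have h : HasFDerivAt (fun z : E₁ × E₂ => a z.1 * b z.2) _ y :=
    (ha.hasFDerivAt.comp y hasFDerivAt_fst).mul (hb.hasFDerivAt.comp y hasFDerivAt_snd)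
  rw [h.fderiv]
  simp
  ring

theorem fderiv_comp_fst_apply {a : E₁ → ℝ} (ha : DifferentiableAt ℝ a y.1) (v : E₁ × E₂) :
    fderiv ℝ (fun z : E₁ × E₂ => a z.1) y v = fderiv ℝ a y.1 v.1 := by
  have h : HasFDerivAt (fun z : E₁ × E₂ => a z.1) _ y := ha.hasFDerivAt.comp y hasFDerivAt_fst
  rw [h.fderiv]
  simp

theorem differentiableAt_fst_mul_snd {a : E₁ → ℝ} {b : E₂ → ℝ} (ha : DifferentiableAt ℝ a y.1)
    (hb : DifferentiableAt ℝ b y.2) :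
    DifferentiableAt ℝ (fun z : E₁ × E₂ => a z.1 * b z.2) y :=
  (ha.comp y differentiableAt_fst).mul (hb.comp y differentiableAt_snd)

variable [FiniteDimensional ℝ E₁] [FiniteDimensional ℝ E₂]

theorem isMetricOn_warped (h₁ : IsMetricOn G₁ U₁) (h₂ : IsMetricOn G₂ U₂)
    (hf : ContDiffOn ℝ ∞ f U₁) (hf0 : ∀ z ∈ U₁, f z ≠ 0) :
    IsMetricOn (warped G₁ G₂ f) (U₁ ×ˢ U₂) where
  isOpen := h₁.isOpen.prod h₂.isOpen
  smooth := by
    refine contDiffOn_bilin_of_apply fun u v => ?_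
    have e₁ : ContDiffOn ℝ ∞ (fun z : E₁ × E₂ => G₁ z.1 u.1 v.1) (U₁ ×ˢ U₂) :=
      ((h₁.smooth.clm_apply contDiffOn_const).clm_apply contDiffOn_const).comp
        contDiffOn_fst fun z hz => hz.1
    have e₂ : ContDiffOn ℝ ∞ (fun z : E₁ × E₂ => G₂ z.2 u.2 v.2) (U₁ ×ˢ U₂) :=
      ((h₂.smooth.clm_apply contDiffOn_const).clm_apply contDiffOn_const).comp
        contDiffOn_snd fun z hz => hz.2
    have e₃ : ContDiffOn ℝ ∞ (fun z : E₁ × E₂ => f z.1) (U₁ ×ˢ U₂) :=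
      hf.comp contDiffOn_fst fun z hz => hz.1
    exact e₁.add (e₃.mul e₂)
  symm := fun y hy u v => by
    rw [warped_apply, warped_apply, h₁.symm _ hy.1, h₂.symm _ hy.2]
  invertible := fun y hy => by
    refine isInvertible_of_nondegenerate fun v hv => ?_
    -- Testing against `(w, 0)` and `(0, w)` separates the factors; the second test needs `f ≠ 0`.
    refine Prod.ext (h₁.ext hy.1 fun w => ?_) (h₂.ext hy.2 fun w => ?_)
    · simpa [warped_apply] using hv (w, 0)
    · simpa [warped_apply, hf0 _ hy.1] using hv (0, w)

/-- The data of a warped product of local metrics near the point `y`. -/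
structure IsWarpedAt (G₁ : E₁ → E₁ →L[ℝ] E₁ →L[ℝ] ℝ) (G₂ : E₂ → E₂ →L[ℝ] E₂ →L[ℝ] ℝ)
    (f : E₁ → ℝ) (U₁ : Set E₁) (U₂ : Set E₂) : Prop where
  base : IsMetricOn G₁ U₁
  fiber : IsMetricOn G₂ U₂
  smooth : ContDiffOn ℝ ∞ f U₁
  ne_zero : ∀ z ∈ U₁, f z ≠ 0

namespace IsWarpedAt

theorem isMetricOn (h : IsWarpedAt G₁ G₂ f U₁ U₂) : IsMetricOn (warped G₁ G₂ f) (U₁ ×ˢ U₂) :=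
  isMetricOn_warped h.base h.fiber h.smooth h.ne_zero

theorem contDiffAt (h : IsWarpedAt G₁ G₂ f U₁ U₂) {z : E₁} (hz : z ∈ U₁) : ContDiffAt ℝ ∞ f z :=
  h.smooth.contDiffAt (h.base.mem_nhds hz)

theorem differentiableAt (h : IsWarpedAt G₁ G₂ f U₁ U₂) {z : E₁} (hz : z ∈ U₁) :
    DifferentiableAt ℝ f z := (h.contDiffAt hz).differentiableAt (by simp)

theorem fderiv_warped (h : IsWarpedAt G₁ G₂ f U₁ U₂) (hy : y ∈ U₁ ×ˢ U₂) (u v w : E₁ × E₂) :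
    fderiv ℝ (warped G₁ G₂ f) y u v w = fderiv ℝ G₁ y.1 u.1 v.1 w.1
      + fderiv ℝ f y.1 u.1 * G₂ y.2 v.2 w.2 + f y.1 * fderiv ℝ G₂ y.2 u.2 v.2 w.2 := by
  have d₁ := h.base.differentiableAt hy.1
  have d₂ := h.fiber.differentiableAt hy.2
  have d₃ := h.differentiableAt hy.1
  have e : fderiv ℝ (warped G₁ G₂ f) y u v w =
      fderiv ℝ (fun z => warped G₁ G₂ f z v w) y u := by
    rw [fderiv_bilin_apply (h.isMetricOn.differentiableAt hy) (by fun_prop) (by fun_prop)]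
    simp
  have e₁ : fderiv ℝ G₁ y.1 u.1 v.1 w.1 = fderiv ℝ (fun z => G₁ z v.1 w.1) y.1 u.1 := by
    rw [fderiv_bilin_apply d₁ (by fun_prop) (by fun_prop)]
    simp
  have e₂ : fderiv ℝ G₂ y.2 u.2 v.2 w.2 = fderiv ℝ (fun z => G₂ z v.2 w.2) y.2 u.2 := by
    rw [fderiv_bilin_apply d₂ (by fun_prop) (by fun_prop)]
    simp
  have d₁' : DifferentiableAt ℝ (fun z => G₁ z v.1 w.1) y.1 := by fun_prop
  have d₂' : DifferentiableAt ℝ (fun z => G₂ z v.2 w.2) y.2 := by fun_prop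
  rw [e, e₁, e₂]
  simp_rw [warped_apply]
  rw [fderiv_fun_add (d₁'.fun_comp' y differentiableAt_fst) (differentiableAt_fst_mul_snd d₃ d₂'),
    add_apply, fderiv_comp_fst_apply d₁', fderiv_fst_mul_snd d₃ d₂']
  ring

/-- The candidate is verified by pairing with an arbitrary vector. Differentiating the factor `f` in
`f g₂` along the base produces the `df / 2f` terms, and its derivative in the free slot produces `-½
g₂(u,v) grad f`. -/
theorem christoffel_warped (h : IsWarpedAt G₁ G₂ f U₁ U₂) (hy : y ∈ U₁ ×ˢ U₂)
    (u v : E₁ × E₂) :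
    christoffel (warped G₁ G₂ f) y u v =
      (christoffel G₁ y.1 u.1 v.1 + (-(1 / 2) * G₂ y.2 u.2 v.2) • grad G₁ f y.1,
        christoffel G₂ y.2 u.2 v.2 + (1 / (2 * f y.1) * fderiv ℝ f y.1 u.1) • v.2
          + (1 / (2 * f y.1) * fderiv ℝ f y.1 v.1) • u.2) := by
  refine h.isMetricOn.ext hy fun w => ?_
  rw [h.isMetricOn.apply_christoffel hy]
  simp only [h.fderiv_warped hy, warped_apply, map_add, map_smul, add_apply, smul_apply,
    h.base.apply_christoffel hy.1, h.fiber.apply_christoffel hy.2, h.base.apply_grad hy.1,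
    smul_eq_mul]
  have := h.ne_zero _ hy.1
  field_simp
  ring

theorem second_fderiv_warped (h : IsWarpedAt G₁ G₂ f U₁ U₂) (hy : y ∈ U₁ ×ˢ U₂)
    (u v a b : E₁ × E₂) :
    fderiv ℝ (fderiv ℝ (warped G₁ G₂ f)) y u v a b =
      fderiv ℝ (fderiv ℝ G₁) y.1 u.1 v.1 a.1 b.1
      + fderiv ℝ (fderiv ℝ f) y.1 u.1 v.1 * G₂ y.2 a.2 b.2
      + fderiv ℝ f y.1 v.1 * fderiv ℝ G₂ y.2 u.2 a.2 b.2
      + fderiv ℝ f y.1 u.1 * fderiv ℝ G₂ y.2 v.2 a.2 b.2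
      + f y.1 * fderiv ℝ (fderiv ℝ G₂) y.2 u.2 v.2 a.2 b.2 := by
  have d₂ := h.fiber.differentiableAt hy.2
  have d₃ := h.differentiableAt hy.1
  have d₁' := h.base.differentiableAt_fderiv_apply hy.1 v.1 a.1 b.1
  have d₂' := h.fiber.differentiableAt_fderiv_apply hy.2 v.2 a.2 b.2
  have d₄ : DifferentiableAt ℝ (fun z => G₂ z a.2 b.2) y.2 := by fun_prop
  have d₅ : DifferentiableAt ℝ (fun z => fderiv ℝ f z v.1) y.1 :=
    (((h.contDiffAt hy.1).fderiv_right (m := ∞) (by simp)).clm_apply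
      contDiffAt_const).differentiableAt (by simp)
  have e₂ : fderiv ℝ (fun z => G₂ z a.2 b.2) y.2 u.2 = fderiv ℝ G₂ y.2 u.2 a.2 b.2 := by
    rw [fderiv_bilin_apply d₂ (by fun_prop) (by fun_prop)]
    simp
  have e : (fun z => fderiv ℝ (warped G₁ G₂ f) z v a b) =ᶠ[nhds y]
      fun z => fderiv ℝ G₁ z.1 v.1 a.1 b.1 + fderiv ℝ f z.1 v.1 * G₂ z.2 a.2 b.2
        + f z.1 * fderiv ℝ G₂ z.2 v.2 a.2 b.2 := by
    filter_upwards [h.isMetricOn.mem_nhds hy] with z hz using h.fderiv_warped hz v a b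
  rw [← h.isMetricOn.fderiv_fderiv_apply hy, e.fderiv_eq,
    fderiv_fun_add ((d₁'.fun_comp' y differentiableAt_fst).fun_add
      (differentiableAt_fst_mul_snd d₅ d₄)) (differentiableAt_fst_mul_snd d₃ d₂'),
    fderiv_fun_add (d₁'.fun_comp' y differentiableAt_fst) (differentiableAt_fst_mul_snd d₅ d₄),
    add_apply, add_apply, fderiv_comp_fst_apply d₁', fderiv_fst_mul_snd d₅ d₄,
    fderiv_fst_mul_snd d₃ d₂', h.base.fderiv_fderiv_apply hy.1, h.fiber.fderiv_fderiv_apply hy.2,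
    LocalMetric.fderiv_fderiv_apply (h.contDiffAt hy.1), e₂]
  ring

/-- In invariant form, `R = R₁ + f R₂ + f² P G₂ - f (T ∧ g₂)`. The pairing of two gradient terms
gives `P`; the second derivatives of `f`, corrected by Christoffel and `df ⊗ df` terms, assemble
into `T`. -/
theorem riem_warped (h : IsWarpedAt G₁ G₂ f U₁ U₂) (hy : y ∈ U₁ ×ˢ U₂) (i j k l : E₁ × E₂) :
    riem (warped G₁ G₂ f) y i j k l =
      riem G₁ y.1 i.1 j.1 k.1 l.1 + f y.1 * riem G₂ y.2 i.2 j.2 k.2 l.2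
      + f y.1 ^ 2 * warpP G₁ f y.1 *
        (G₂ y.2 i.2 l.2 * G₂ y.2 j.2 k.2 - G₂ y.2 i.2 k.2 * G₂ y.2 j.2 l.2)
      - f y.1 * (warpT G₁ f y.1 i.1 l.1 * G₂ y.2 j.2 k.2 + warpT G₁ f y.1 j.1 k.1 * G₂ y.2 i.2 l.2
        - warpT G₁ f y.1 i.1 k.1 * G₂ y.2 j.2 l.2 - warpT G₁ f y.1 j.1 l.1 * G₂ y.2 i.2 k.2) := by
  have hf0 := h.ne_zero _ hy.1
  rw [h.isMetricOn.riem_eq hy, h.base.riem_eq hy.1, h.fiber.riem_eq hy.2]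
  have hT : ∀ a b : E₁, f y.1 * warpT G₁ f y.1 a b = -(1 / 2) * (fderiv ℝ (fderiv ℝ f) y.1 a b
      - fderiv ℝ f y.1 (christoffel G₁ y.1 a b)
      - 1 / (2 * f y.1) * (fderiv ℝ f y.1 a * fderiv ℝ f y.1 b)) := fun a b => by
    rw [warpT_eq (h.contDiffAt hy.1), h.base.christoffel_comm hy.1 a b,
      LocalMetric.fderiv_fderiv_comm (h.contDiffAt hy.1) a b]
    field_simp
  -- Distributing `f` makes each product `f T` appear literally, so that `hT` can rewrite it.
  have e : ∀ A B C D a b c d : ℝ, f y.1 * (A * a + B * b - C * c - D * d) =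
      (f y.1 * A) * a + (f y.1 * B) * b - (f y.1 * C) * c - (f y.1 * D) * d := by
    intros; ring
  rw [e]
  -- First derivatives of `G₂` become Christoffel terms, and symmetric arguments are put in a fixed
  -- order, so that both sides are rational expressions in the same atoms.
  simp only [hT, h.second_fderiv_warped hy, h.christoffel_warped hy, warped_apply, map_add,
    map_smul, add_apply, smul_apply, smul_eq_mul, h.base.apply_grad hy.1,
    h.base.apply_grad_right hy.1, fderiv_grad hf0, h.fiber.fderiv_eq hy.2,
    h.fiber.symm _ hy.2 i.2 (christoffel _ _ _ _), h.fiber.symm _ hy.2 j.2 (christoffel _ _ _ _),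
    h.fiber.symm _ hy.2 k.2 (christoffel _ _ _ _),
    h.fiber.christoffel_comm hy.2 j.2 i.2, h.fiber.christoffel_comm hy.2 k.2 i.2,
    h.fiber.christoffel_comm hy.2 l.2 i.2, h.fiber.christoffel_comm hy.2 k.2 j.2,
    h.fiber.christoffel_comm hy.2 l.2 j.2, h.fiber.christoffel_comm hy.2 l.2 k.2,
    h.fiber.symm _ hy.2 j.2 i.2, h.fiber.symm _ hy.2 k.2 i.2,
    h.fiber.symm _ hy.2 k.2 j.2]
  field_simp
  ring

end IsWarpedAt

end Warped

/-! ### The covariant derivative of the warped curvature -/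

section Warped

variable {E₁ : Type*} [NormedAddCommGroup E₁] [NormedSpace ℝ E₁]
  {E₂ : Type*} [NormedAddCommGroup E₂] [NormedSpace ℝ E₂]
  {G₁ : E₁ → E₁ →L[ℝ] E₁ →L[ℝ] ℝ} {G₂ : E₂ → E₂ →L[ℝ] E₂ →L[ℝ] ℝ} {f : E₁ → ℝ}
  {U₁ : Set E₁} {U₂ : Set E₂} {y : E₁ × E₂}

/-- The defect of the identity `f^d R_{abcd} = -(f_a T_{bc} - f_b T_{ac})`. -/
def gradDefect (G : E₁ → E₁ →L[ℝ] E₁ →L[ℝ] ℝ) (f : E₁ → ℝ) (y a b c : E₁) : ℝ :=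
  riem G y a b c (grad G f y)
    + (fderiv ℝ f y a * warpT G f y b c - fderiv ℝ f y b * warpT G f y a c)

/-- The defect of the identity `df ⊗ R₂ = f² dP ⊗ (½ g₂ ∧ g₂)`. -/
def fiberDefect (G₁ : E₁ → E₁ →L[ℝ] E₁ →L[ℝ] ℝ) (G₂ : E₂ → E₂ →L[ℝ] E₂ →L[ℝ] ℝ) (f : E₁ → ℝ)
    (y : E₁ × E₂) (e : E₁) (i j k l : E₂) : ℝ :=
  fderiv ℝ f y.1 e * riem G₂ y.2 i j k l
    - f y.1 ^ 2 * fderiv ℝ (warpP G₁ f) y.1 e *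
      (G₂ y.2 i l * G₂ y.2 j k - G₂ y.2 i k * G₂ y.2 j l)

variable [FiniteDimensional ℝ E₁] [FiniteDimensional ℝ E₂]

namespace IsWarpedAt

theorem fderiv_riem_warped (h : IsWarpedAt G₁ G₂ f U₁ U₂) (hy : y ∈ U₁ ×ˢ U₂)
    (e i j k l : E₁ × E₂) :
    fderiv ℝ (fun z => riem (warped G₁ G₂ f) z i j k l) y e =
      fderiv ℝ (fun z => riem G₁ z i.1 j.1 k.1 l.1) y.1 e.1
      + (fderiv ℝ f y.1 e.1 * riem G₂ y.2 i.2 j.2 k.2 l.2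
        + f y.1 * fderiv ℝ (fun z => riem G₂ z i.2 j.2 k.2 l.2) y.2 e.2)
      + ((2 * f y.1 * fderiv ℝ f y.1 e.1 * warpP G₁ f y.1
          + f y.1 ^ 2 * fderiv ℝ (warpP G₁ f) y.1 e.1) *
            (G₂ y.2 i.2 l.2 * G₂ y.2 j.2 k.2 - G₂ y.2 i.2 k.2 * G₂ y.2 j.2 l.2)
        + f y.1 ^ 2 * warpP G₁ f y.1 *
          (fderiv ℝ G₂ y.2 e.2 i.2 l.2 * G₂ y.2 j.2 k.2 + G₂ y.2 i.2 l.2 * fderiv ℝ G₂ y.2 e.2 j.2 k.2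
          - fderiv ℝ G₂ y.2 e.2 i.2 k.2 * G₂ y.2 j.2 l.2
          - G₂ y.2 i.2 k.2 * fderiv ℝ G₂ y.2 e.2 j.2 l.2))
      - (fderiv ℝ f y.1 e.1 * (warpT G₁ f y.1 i.1 l.1 * G₂ y.2 j.2 k.2
          + warpT G₁ f y.1 j.1 k.1 * G₂ y.2 i.2 l.2
          - warpT G₁ f y.1 i.1 k.1 * G₂ y.2 j.2 l.2 - warpT G₁ f y.1 j.1 l.1 * G₂ y.2 i.2 k.2)
        + f y.1 * (fderiv ℝ (fun z => warpT G₁ f z i.1 l.1) y.1 e.1 * G₂ y.2 j.2 k.2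
          + fderiv ℝ (fun z => warpT G₁ f z j.1 k.1) y.1 e.1 * G₂ y.2 i.2 l.2
          - fderiv ℝ (fun z => warpT G₁ f z i.1 k.1) y.1 e.1 * G₂ y.2 j.2 l.2
          - fderiv ℝ (fun z => warpT G₁ f z j.1 l.1) y.1 e.1 * G₂ y.2 i.2 k.2)
        + f y.1 * (warpT G₁ f y.1 i.1 l.1 * fderiv ℝ G₂ y.2 e.2 j.2 k.2
          + warpT G₁ f y.1 j.1 k.1 * fderiv ℝ G₂ y.2 e.2 i.2 l.2
          - warpT G₁ f y.1 i.1 k.1 * fderiv ℝ G₂ y.2 e.2 j.2 l.2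
          - warpT G₁ f y.1 j.1 l.1 * fderiv ℝ G₂ y.2 e.2 i.2 k.2)) := by
  have hf := h.contDiffAt hy.1
  have hf0 := h.ne_zero _ hy.1
  have d₂ := h.fiber.differentiableAt hy.2
  have df := h.differentiableAt hy.1
  have dP := (h.base.contDiffAt_warpP hy.1 hf hf0).differentiableAt (by simp)
  have dT : ∀ a b, DifferentiableAt ℝ (fun z => warpT G₁ f z a b) y.1 := fun a b =>
    (h.base.contDiffAt_warpT hy.1 hf hf0 a b).differentiableAt (by simp)
  have dg : ∀ a b, DifferentiableAt ℝ (fun z => G₂ z a b) y.2 := fun a b => by fun_prop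
  have eg : ∀ a b v, fderiv ℝ (fun z => G₂ z a b) y.2 v = fderiv ℝ G₂ y.2 v a b := fun a b v => by
    rw [fderiv_bilin_apply d₂ (by fun_prop) (by fun_prop)]
    simp
  have dR₁ := h.base.differentiableAt_riem hy.1 i.1 j.1 k.1 l.1
  have dR₂ := h.fiber.differentiableAt_riem hy.2 i.2 j.2 k.2 l.2
  have hq : HasFDerivAt (fun z => f z * f z * warpP G₁ f z) _ y.1 :=
    (df.hasFDerivAt.mul df.hasFDerivAt).mul dP.hasFDerivAt
  have hκ : HasFDerivAt (fun z => G₂ z i.2 l.2 * G₂ z j.2 k.2 - G₂ z i.2 k.2 * G₂ z j.2 l.2) _ y.2 :=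
    ((dg i.2 l.2).hasFDerivAt.mul (dg j.2 k.2).hasFDerivAt).sub
      ((dg i.2 k.2).hasFDerivAt.mul (dg j.2 l.2).hasFDerivAt)
  have hT : ∀ a b, HasFDerivAt (fun z => f z * warpT G₁ f z a b) _ y.1 := fun a b =>
    df.hasFDerivAt.mul (dT a b).hasFDerivAt
  have dfT : ∀ a b, DifferentiableAt ℝ (fun z => f z * warpT G₁ f z a b) y.1 := fun a b =>
    (hT a b).differentiableAt
  -- Each summand is grouped as a base factor times a fiber factor, with `f² P` and `f T` treated as
  -- single base functions.
  have germ : (fun z => riem (warped G₁ G₂ f) z i j k l) =ᶠ[nhds y] fun z =>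
      riem G₁ z.1 i.1 j.1 k.1 l.1 + f z.1 * riem G₂ z.2 i.2 j.2 k.2 l.2
      + (f z.1 * f z.1 * warpP G₁ f z.1) *
        (G₂ z.2 i.2 l.2 * G₂ z.2 j.2 k.2 - G₂ z.2 i.2 k.2 * G₂ z.2 j.2 l.2)
      - ((f z.1 * warpT G₁ f z.1 i.1 l.1) * G₂ z.2 j.2 k.2
        + (f z.1 * warpT G₁ f z.1 j.1 k.1) * G₂ z.2 i.2 l.2
        - (f z.1 * warpT G₁ f z.1 i.1 k.1) * G₂ z.2 j.2 l.2
        - (f z.1 * warpT G₁ f z.1 j.1 l.1) * G₂ z.2 i.2 k.2) := by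
    filter_upwards [h.isMetricOn.mem_nhds hy] with z hz
    rw [h.riem_warped hz]
    ring
  have m₁ := dR₁.fun_comp' y differentiableAt_fst
  have m₂ := differentiableAt_fst_mul_snd df dR₂
  have m₃ := differentiableAt_fst_mul_snd hq.differentiableAt hκ.differentiableAt
  have m₄ := differentiableAt_fst_mul_snd (dfT i.1 l.1) (dg j.2 k.2)
  have m₅ := differentiableAt_fst_mul_snd (dfT j.1 k.1) (dg i.2 l.2)
  have m₆ := differentiableAt_fst_mul_snd (dfT i.1 k.1) (dg j.2 l.2)
  have m₇ := differentiableAt_fst_mul_snd (dfT j.1 l.1) (dg i.2 k.2)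
  rw [germ.fderiv_eq, fderiv_fun_sub ((m₁.fun_add m₂).fun_add m₃) (((m₄.fun_add m₅).fun_sub m₆).fun_sub m₇),
    fderiv_fun_add (m₁.fun_add m₂) m₃, fderiv_fun_add m₁ m₂,
    fderiv_fun_sub ((m₄.fun_add m₅).fun_sub m₆) m₇, fderiv_fun_sub (m₄.fun_add m₅) m₆,
    fderiv_fun_add m₄ m₅]
  simp only [add_apply, sub_apply]
  rw [fderiv_comp_fst_apply dR₁, fderiv_fst_mul_snd df dR₂,
    fderiv_fst_mul_snd hq.differentiableAt hκ.differentiableAt,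
    fderiv_fst_mul_snd (dfT i.1 l.1) (dg j.2 k.2), fderiv_fst_mul_snd (dfT j.1 k.1) (dg i.2 l.2),
    fderiv_fst_mul_snd (dfT i.1 k.1) (dg j.2 l.2), fderiv_fst_mul_snd (dfT j.1 l.1) (dg i.2 k.2),
    hq.fderiv, hκ.fderiv, (hT i.1 l.1).fderiv, (hT j.1 k.1).fderiv, (hT i.1 k.1).fderiv,
    (hT j.1 l.1).fderiv]
  simp only [add_apply, sub_apply, smul_apply, smul_eq_mul, Pi.mul_apply, eg]
  ring

/-- The connection terms that mix the factors explain the extra summands. For `e` in the base, `∂_e`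
of `f R₂` gives `df(e) R₂`, while the four slots together subtract `2 df(e) R₂`; with the analogous
count for `f² P G₂` the result is `-fiberDefect`. For `f (T ∧ g₂)` the same count cancels and only
`f ∇T` survives. For `e` in the fiber, the term `-½ g₂(e,·) grad f` inserts the gradient into `R₁`
and `T`, and the term `df(·)/2f` inserts `e` into the slots of `R₂` and `g₂`. These give the halves
of `gradDefect` and `fiberDefect`. -/
theorem nablaRiem_warped (h : IsWarpedAt G₁ G₂ f U₁ U₂) (hy : y ∈ U₁ ×ˢ U₂)
    (e i j k l : E₁ × E₂) :
    nablaRiem (warped G₁ G₂ f) y e i j k l =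
      nablaRiem G₁ y.1 e.1 i.1 j.1 k.1 l.1 + f y.1 * nablaRiem G₂ y.2 e.2 i.2 j.2 k.2 l.2
      - fiberDefect G₁ G₂ f y e.1 i.2 j.2 k.2 l.2
      - f y.1 * (nablaWarpT G₁ f y.1 e.1 i.1 l.1 * G₂ y.2 j.2 k.2
        + nablaWarpT G₁ f y.1 e.1 j.1 k.1 * G₂ y.2 i.2 l.2
        - nablaWarpT G₁ f y.1 e.1 i.1 k.1 * G₂ y.2 j.2 l.2
        - nablaWarpT G₁ f y.1 e.1 j.1 l.1 * G₂ y.2 i.2 k.2)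
      + 1 / 2 * (G₂ y.2 e.2 l.2 * gradDefect G₁ f y.1 i.1 j.1 k.1
        - G₂ y.2 e.2 k.2 * gradDefect G₁ f y.1 i.1 j.1 l.1
        + G₂ y.2 e.2 j.2 * gradDefect G₁ f y.1 k.1 l.1 i.1
        - G₂ y.2 e.2 i.2 * gradDefect G₁ f y.1 k.1 l.1 j.1)
      - 1 / 2 * (fiberDefect G₁ G₂ f y i.1 e.2 j.2 k.2 l.2
        + fiberDefect G₁ G₂ f y j.1 i.2 e.2 k.2 l.2
        + fiberDefect G₁ G₂ f y k.1 i.2 j.2 e.2 l.2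
        + fiberDefect G₁ G₂ f y l.1 i.2 j.2 k.2 e.2) := by
  have hf := h.contDiffAt hy.1
  have hf0 := h.ne_zero _ hy.1
  -- The curvature symmetries move a gradient from any slot to the last one, the form used in
  -- `gradDefect`.
  have g₁ : ∀ b c d, riem G₁ y.1 (grad G₁ f y.1) b c d = -riem G₁ y.1 c d b (grad G₁ f y.1) :=
    fun b c d => by rw [h.base.riem_pair_symm hy.1, h.base.riem_skew_right hy.1]
  have g₂ : ∀ a c d, riem G₁ y.1 a (grad G₁ f y.1) c d = riem G₁ y.1 c d a (grad G₁ f y.1) :=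
    fun a c d => by rw [h.base.riem_pair_symm hy.1]
  have g₃ : ∀ a b d, riem G₁ y.1 a b (grad G₁ f y.1) d = -riem G₁ y.1 a b d (grad G₁ f y.1) :=
    fun a b d => by rw [h.base.riem_skew_right hy.1]
  have t₁ : ∀ a, warpT G₁ f y.1 a (grad G₁ f y.1) = -(fderiv ℝ f y.1 a * warpP G₁ f y.1)
      - f y.1 * fderiv ℝ (warpP G₁ f) y.1 a := h.base.warpT_grad hy.1 hf hf0
  have t₂ : ∀ a, warpT G₁ f y.1 (grad G₁ f y.1) a = -(fderiv ℝ f y.1 a * warpP G₁ f y.1)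
      - f y.1 * fderiv ℝ (warpP G₁ f) y.1 a := fun a => by
    rw [h.base.warpT_comm hy.1 hf, t₁]
  rw [nablaRiem, covDeriv₄, h.fderiv_riem_warped hy]
  simp only [nablaRiem, covDeriv₄, nablaWarpT, covDeriv₂, gradDefect, fiberDefect]
  simp only [h.christoffel_warped hy, h.riem_warped hy,
    h.base.riem_add₁ hy.1, h.base.riem_add₂ hy.1, h.base.riem_add₃ hy.1, h.base.riem_add₄ hy.1,
    h.base.riem_smul₁ hy.1, h.base.riem_smul₂ hy.1, h.base.riem_smul₃ hy.1, h.base.riem_smul₄ hy.1,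
    h.fiber.riem_add₁ hy.2, h.fiber.riem_add₂ hy.2, h.fiber.riem_add₃ hy.2, h.fiber.riem_add₄ hy.2,
    h.fiber.riem_smul₁ hy.2, h.fiber.riem_smul₂ hy.2, h.fiber.riem_smul₃ hy.2,
    h.fiber.riem_smul₄ hy.2, warpT_add_left hf, warpT_smul_left hf, h.base.warpT_add_right hy.1 hf,
    h.base.warpT_smul_right hy.1 hf, g₁, g₂, g₃, t₁, t₂, map_add, map_smul, add_apply, smul_apply,
    smul_eq_mul, h.fiber.fderiv_eq hy.2,
    h.base.warpT_comm hy.1 hf l.1 i.1, h.base.warpT_comm hy.1 hf k.1 i.1,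
    h.base.warpT_comm hy.1 hf l.1 j.1, h.base.warpT_comm hy.1 hf k.1 j.1,
    h.fiber.symm _ hy.2 i.2 e.2, h.fiber.symm _ hy.2 j.2 e.2]
  field_simp
  ring

end IsWarpedAt

end Warped

/-! ### Ricci tensor of the warped product and the pointwise equivalence -/

section Warped

variable {E₁ : Type*} [NormedAddCommGroup E₁] [NormedSpace ℝ E₁]
  {E₂ : Type*} [NormedAddCommGroup E₂] [NormedSpace ℝ E₂]
  {G₁ : E₁ → E₁ →L[ℝ] E₁ →L[ℝ] ℝ} {G₂ : E₂ → E₂ →L[ℝ] E₂ →L[ℝ] ℝ} {f : E₁ → ℝ}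
  {U₁ : Set E₁} {U₂ : Set E₂} {y : E₁ × E₂}
  [FiniteDimensional ℝ E₁] [FiniteDimensional ℝ E₂]

/-- The vector `b^i` of the basis metrically dual to the basis used for traces. -/
def dualVec {E : Type*} [NormedAddCommGroup E] [NormedSpace ℝ E] [FiniteDimensional ℝ E]
    (G : E → E →L[ℝ] E →L[ℝ] ℝ) (y : E) (i : Fin (Module.finrank ℝ E)) : E :=
  sharp G y (LinearMap.toContinuousLinearMap ((Module.finBasis ℝ E).coord i))

theorem IsMetricOn.apply_dualVec {E : Type*} [NormedAddCommGroup E] [NormedSpace ℝ E]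
    [FiniteDimensional ℝ E] {G : E → E →L[ℝ] E →L[ℝ] ℝ} {U : Set E} {y : E}
    (h : IsMetricOn G U) (hy : y ∈ U) (i : Fin (Module.finrank ℝ E)) (v : E) :
    G y v (dualVec G y i) = (Module.finBasis ℝ E).coord i v := by
  rw [h.symm y hy, dualVec, h.apply_sharp hy]
  rfl

theorem IsMetricOn.sum_riem_dualVec {E : Type*} [NormedAddCommGroup E] [NormedSpace ℝ E]
    [FiniteDimensional ℝ E] {G : E → E →L[ℝ] E →L[ℝ] ℝ} {U : Set E} {y : E}
    (h : IsMetricOn G U) (hy : y ∈ U) (j k : E) :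
    ∑ i, riem G y (Module.finBasis ℝ E i) j k (dualVec G y i) = ricci G y j k := by
  simp only [riem, h.apply_dualVec hy, ricci]

namespace IsWarpedAt

/-- Trace of `riem_warped` over a product basis. The base vectors contribute `S₁` and `-f tr T g₂`;
the fiber vectors contribute `S₂`, `-T` once for each of the `m` basis vectors, and `(m - 1) f P
g₂`, where one copy is lost to the second term of `G₂`. -/
theorem ricci_warped (h : IsWarpedAt G₁ G₂ f U₁ U₂) (hy : y ∈ U₁ ×ˢ U₂) (j k : E₁ × E₂) :
    ricci (warped G₁ G₂ f) y j k =
      ricci G₁ y.1 j.1 k.1 - (Module.finrank ℝ E₂ : ℝ) * warpT G₁ f y.1 j.1 k.1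
      + (ricci G₂ y.2 j.2 k.2
        + f y.1 * (((Module.finrank ℝ E₂ : ℝ) - 1) * warpP G₁ f y.1
          - metricTrace G₁ y.1 (warpT G₁ f y.1)) * G₂ y.2 j.2 k.2) := by
  have hf0 := h.ne_zero _ hy.1
  set b₁ := Module.finBasis ℝ E₁
  set b₂ := Module.finBasis ℝ E₂
  have key₁ : ∀ i, b₁.coord i (curvOp (warped G₁ G₂ f) y (b₁ i, 0) j k).1 =
      riem G₁ y.1 (b₁ i) j.1 k.1 (dualVec G₁ y.1 i)
        - f y.1 * G₂ y.2 j.2 k.2 * warpT G₁ f y.1 (b₁ i) (dualVec G₁ y.1 i) := fun i => by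
    -- Pairing with the metrically dual vector reads off the `i`-th coordinate.
    have e := h.riem_warped hy (b₁ i, 0) j k (dualVec G₁ y.1 i, 0)
    rw [riem, warped_apply, h.base.apply_dualVec hy.1] at e
    simp only [map_zero, mul_zero, add_zero, zero_apply, riem_zero₁, sub_zero, zero_mul] at e
    rw [e]
    ring
  have key₂ : ∀ i, b₂.coord i (curvOp (warped G₁ G₂ f) y (0, b₂ i) j k).2 =
      riem G₂ y.2 (b₂ i) j.2 k.2 (dualVec G₂ y.2 i)
        + f y.1 * warpP G₁ f y.1 * (G₂ y.2 j.2 k.2 - G₂ y.2 (b₂ i) k.2 * b₂.coord i j.2)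
        - warpT G₁ f y.1 j.1 k.1 := fun i => by
    have e := h.riem_warped hy (0, b₂ i) j k (0, dualVec G₂ y.2 i)
    rw [riem, warped_apply, h.fiber.apply_dualVec hy.2] at e
    simp only [h.fiber.apply_dualVec hy.2, map_zero, riem_zero₁, zero_add,
      warpT_zero_left, warpT_zero_right, zero_mul, sub_zero] at e
    have hb : (Module.finBasis ℝ E₂).coord i (b₂ i) = 1 := by simp [b₂]
    rw [hb] at e
    -- On the fiber the metric is `f g₂`, so pairing with the `g₂`-dual vector gives `f` times the
    -- coordinate.
    apply mul_left_cancel₀ hf0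
    rw [e]
    ring
  have key₃ : ∑ i, G₂ y.2 (b₂ i) k.2 * b₂.coord i j.2 = G₂ y.2 j.2 k.2 := by
    conv_rhs => rw [← b₂.sum_repr j.2]
    rw [map_sum, sum_apply]
    refine Finset.sum_congr rfl fun i _ => ?_
    simp [mul_comm]
  rw [h.isMetricOn.ricci_eq_sum hy (b₁.prod b₂), Fintype.sum_sum_type]
  have c₁ : ∀ i (v : E₁ × E₂), (b₁.prod b₂).coord (Sum.inl i) v = b₁.coord i v.1 := fun i v => by
    simp
  have c₂ : ∀ i (v : E₁ × E₂), (b₁.prod b₂).coord (Sum.inr i) v = b₂.coord i v.2 := fun i v => by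
    simp
  have c₃ : ∀ i, (b₁.prod b₂) (Sum.inl i) = (b₁ i, 0) := fun i => by simp
  have c₄ : ∀ i, (b₁.prod b₂) (Sum.inr i) = (0, b₂ i) := fun i => by simp
  simp only [c₁, c₂, c₃, c₄, key₁, key₂]
  rw [Finset.sum_sub_distrib, Finset.sum_sub_distrib, Finset.sum_add_distrib, ← Finset.mul_sum,
    ← Finset.mul_sum, Finset.sum_sub_distrib, key₃, h.base.sum_riem_dualVec hy.1,
    h.fiber.sum_riem_dualVec hy.2]
  have e₁ : ∑ i, warpT G₁ f y.1 (b₁ i) (dualVec G₁ y.1 i) =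
    metricTrace G₁ y.1 (warpT G₁ f y.1) := rfl
  rw [e₁]
  simp only [Finset.sum_const, Finset.card_univ, Fintype.card_fin, nsmul_eq_mul]
  ring

-- Linear algebra at one point: restricting a multilinear identity on `E₁ × E₂` to pure vectors
-- loses nothing. The defects appear in types of slots where the right side vanishes, so they must
-- be zero.
set_option maxHeartbeats 2000000 in
theorem hgk_iff (h : IsWarpedAt G₁ G₂ f U₁ U₂) (hy : y ∈ U₁ ×ˢ U₂)
    (hdim : 1 ≤ Module.finrank ℝ E₂) (Pi Psi : E₁ × E₂ →L[ℝ] ℝ) (m Q : ℝ)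
    (hm : m = (Module.finrank ℝ E₂ : ℝ))
    (hQ : Q = f y.1 * ((m - 1) * warpP G₁ f y.1 - metricTrace G₁ y.1 (warpT G₁ f y.1))) :
    (∀ e i j k l : E₁ × E₂, nablaRiem (warped G₁ G₂ f) y e i j k l =
      Pi e * riem (warped G₁ G₂ f) y i j k l
      + Psi e * kulkarniNomizu (fun v w => warped G₁ G₂ f y v w) (ricci (warped G₁ G₂ f) y) i j k l) ↔
    (∀ e a b c d : E₁, nablaRiem G₁ y.1 e a b c d =
      Pi (e, 0) * riem G₁ y.1 a b c d
      + Psi (e, 0) * kulkarniNomizu (fun v w => G₁ y.1 v w) (ricci G₁ y.1) a b c d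
      - m * Psi (e, 0) * kulkarniNomizu (fun v w => G₁ y.1 v w) (warpT G₁ f y.1) a b c d) ∧
    (∀ (ε : E₂) (a b c d : E₁), -(Pi (0, ε) * riem G₁ y.1 a b c d) =
      Psi (0, ε) * kulkarniNomizu (fun v w => G₁ y.1 v w) (ricci G₁ y.1) a b c d
      - m * Psi (0, ε) * kulkarniNomizu (fun v w => G₁ y.1 v w) (warpT G₁ f y.1) a b c d) ∧
    (∀ (e : E₁) (α β γ δ : E₂),
      -((fderiv ℝ f y.1 e + f y.1 * Pi (e, 0)) * riem G₂ y.2 α β γ δ) =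
      f y.1 * Psi (e, 0) * kulkarniNomizu (fun v w => G₂ y.2 v w) (ricci G₂ y.2) α β γ δ
      + (1 / 2 * f y.1 ^ 2 * (warpP G₁ f y.1 * Pi (e, 0) - fderiv ℝ (warpP G₁ f) y.1 e)
          + f y.1 * Q * Psi (e, 0)) *
        kulkarniNomizu (fun v w => G₂ y.2 v w) (fun v w => G₂ y.2 v w) α β γ δ) ∧
    (∀ ε α β γ δ : E₂, f y.1 * nablaRiem G₂ y.2 ε α β γ δ =
      f y.1 * Pi (0, ε) * riem G₂ y.2 α β γ δ
      + f y.1 * Psi (0, ε) * kulkarniNomizu (fun v w => G₂ y.2 v w) (ricci G₂ y.2) α β γ δ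
      + (1 / 2 * f y.1 ^ 2 * warpP G₁ f y.1 * Pi (0, ε) + f y.1 * Q * Psi (0, ε)) *
        kulkarniNomizu (fun v w => G₂ y.2 v w) (fun v w => G₂ y.2 v w) α β γ δ) ∧
    (∀ (e a b : E₁) (α β : E₂), Psi (e, 0) * G₁ y.1 a b * ricci G₂ y.2 α β =
      -(f y.1 * (nablaWarpT G₁ f y.1 e a b - Pi (e, 0) * warpT G₁ f y.1 a b)
        + f y.1 * Psi (e, 0) * (ricci G₁ y.1 a b - m * warpT G₁ f y.1 a b)
        + Q * Psi (e, 0) * G₁ y.1 a b) * G₂ y.2 α β) ∧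
    (∀ (ε : E₂) (a b : E₁) (α β : E₂), Psi (0, ε) * G₁ y.1 a b * ricci G₂ y.2 α β =
      -(-(f y.1 * Pi (0, ε) * warpT G₁ f y.1 a b)
        + f y.1 * Psi (0, ε) * (ricci G₁ y.1 a b - m * warpT G₁ f y.1 a b)
        + Q * Psi (0, ε) * G₁ y.1 a b) * G₂ y.2 α β) ∧
    (∀ a b c : E₁, riem G₁ y.1 a b c (grad G₁ f y.1) =
      -(fderiv ℝ f y.1 a * warpT G₁ f y.1 b c - fderiv ℝ f y.1 b * warpT G₁ f y.1 a c)) ∧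
    (∀ (e : E₁) (α β γ δ : E₂), fderiv ℝ f y.1 e * riem G₂ y.2 α β γ δ =
      f y.1 ^ 2 * fderiv ℝ (warpP G₁ f) y.1 e *
        (1 / 2 * kulkarniNomizu (fun v w => G₂ y.2 v w) (fun v w => G₂ y.2 v w) α β γ δ)) := by
  have hric : ∀ j k : E₁ × E₂, ricci (warped G₁ G₂ f) y j k =
      ricci G₁ y.1 j.1 k.1 - m * warpT G₁ f y.1 j.1 k.1
      + (ricci G₂ y.2 j.2 k.2 + Q * G₂ y.2 j.2 k.2) := fun j k => by
    rw [h.ricci_warped hy, hQ, hm]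
  simp only [h.nablaRiem_warped hy, h.riem_warped hy, kulkarniNomizu, hric, warped_apply]
  constructor
  · intro H
    refine ⟨fun e a b c d => ?_, fun ε a b c d => ?_, fun e α β γ δ => ?_, fun ε α β γ δ => ?_,
      fun e a b α β => ?_, fun ε a b α β => ?_, fun a b c => ?_, fun e α β γ δ => ?_⟩
    -- Each condition is the identity on one type of slots. The unmixed types give conditions 1 and
    -- 2, and the types with base and fiber vectors paired give 3. Three base vectors among `i, j,
    -- k, l` with a fiber derivative give 4(i), and three fiber vectors with a fiber derivative give
    -- 4(ii).
    · have := H (e, 0) (a, 0) (b, 0) (c, 0) (d, 0)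
      simp [fiberDefect] at this
      linarith
    · have := H (0, ε) (a, 0) (b, 0) (c, 0) (d, 0)
      simp [fiberDefect] at this
      linarith
    · have := H (e, 0) (0, α) (0, β) (0, γ) (0, δ)
      simp [fiberDefect, gradDefect] at this
      linarith
    · have := H (0, ε) (0, α) (0, β) (0, γ) (0, δ)
      simp [fiberDefect, gradDefect] at this
      linarith
    · have := H (e, 0) (a, 0) (0, α) (0, β) (b, 0)
      simp [fiberDefect, gradDefect] at this
      linarith
    · have := H (0, ε) (a, 0) (0, α) (0, β) (b, 0)
      simp [fiberDefect, gradDefect] at this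
      linarith
    -- This type only yields `½ g₂(v,w) gradDefect = 0`. A positive-dimensional nondegenerate fiber
    -- supplies `v, w` with `g₂(v,w) ≠ 0`.
    · obtain ⟨v, hv⟩ : ∃ v : E₂, v ≠ 0 :=
        have := Module.finrank_pos_iff.1 (Nat.lt_of_lt_of_le zero_lt_one hdim)
        exists_ne 0
      obtain ⟨w, hw⟩ : ∃ w, G₂ y.2 v w ≠ 0 := by
        by_contra! hc
        exact hv (h.fiber.ext hy.2 fun w => by simpa using hc w)
      have := H (0, v) (a, 0) (b, 0) (c, 0) (0, w)
      simp [fiberDefect, gradDefect, hw] at this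
      linarith
    · have := H (0, α) (e, 0) (0, β) (0, γ) (0, δ)
      simp [fiberDefect, gradDefect] at this
      linarith
  · rintro ⟨bb, bf, fb, ff, mb, mf, gc, dc⟩ e i j k l
    have hPi : Pi e = Pi (e.1, 0) + Pi (0, e.2) := by rw [← map_add]; simp
    have hPsi : Psi e = Psi (e.1, 0) + Psi (0, e.2) := by rw [← map_add]; simp
    rw [hPi, hPsi]
    simp only [fiberDefect, gradDefect]
    -- The four signed copies of each mixed condition are the four terms of a Kulkarni-Nomizu
    -- product. They enter with reversed sign because condition 3 has the `Ψ ⊗ g₁ ⊗ S₂` term on its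
    -- left. The coefficients `½` are those of `nablaRiem_warped`.
    linear_combination bb e.1 i.1 j.1 k.1 l.1 + bf e.2 i.1 j.1 k.1 l.1
      + fb e.1 i.2 j.2 k.2 l.2 + ff e.2 i.2 j.2 k.2 l.2
      - mb e.1 i.1 l.1 j.2 k.2 - mb e.1 j.1 k.1 i.2 l.2
      + mb e.1 i.1 k.1 j.2 l.2 + mb e.1 j.1 l.1 i.2 k.2
      - mf e.2 i.1 l.1 j.2 k.2 - mf e.2 j.1 k.1 i.2 l.2
      + mf e.2 i.1 k.1 j.2 l.2 + mf e.2 j.1 l.1 i.2 k.2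
      + 1 / 2 * (G₂ y.2 e.2 l.2 * gc i.1 j.1 k.1 - G₂ y.2 e.2 k.2 * gc i.1 j.1 l.1
        + G₂ y.2 e.2 j.2 * gc k.1 l.1 i.1 - G₂ y.2 e.2 i.2 * gc k.1 l.1 j.1)
      - 1 / 2 * (dc i.1 e.2 j.2 k.2 l.2 + dc j.1 i.2 e.2 k.2 l.2 + dc k.1 i.2 j.2 e.2 l.2
        + dc l.1 i.2 j.2 k.2 e.2)

end IsWarpedAt

end Warped

end LocalMetric

/-! ### From a manifold to a local metric in a chart -/

section Chart

open LocalMetric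

variable {E : Type*} [NormedAddCommGroup E] [NormedSpace ℝ E]
  {M : Type*} [TopologicalSpace M] [ChartedSpace E M]

theorem isInvertible_mfderiv_extChartAt_symm [IsManifold 𝓘(ℝ, E) ∞ M] (x₀ : M) {y : E}
    (hy : y ∈ (extChartAt 𝓘(ℝ, E) x₀).target) :
    (mfderiv 𝓘(ℝ, E) 𝓘(ℝ, E) (extChartAt 𝓘(ℝ, E) x₀).symm y).IsInvertible := by
  have : IsManifold 𝓘(ℝ, E) 1 M := IsManifold.of_le (n := ∞) (by simp)
  have h := isInvertible_mfderivWithin_extChartAt_symm hy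
  rwa [ModelWithCorners.range_eq_univ, mfderivWithin_univ] at h

/-- The tangent space at `x₀` is identified with `E` by the preferred chart at `x₀`, so there the
inverse chart has identity differential. -/
theorem mfderiv_extChartAt_symm_self (x₀ : M) [IsManifold 𝓘(ℝ, E) ∞ M] (v : E) :
    mfderiv 𝓘(ℝ, E) 𝓘(ℝ, E) (extChartAt 𝓘(ℝ, E) x₀).symm (extChartAt 𝓘(ℝ, E) x₀ x₀) v = v := by
  have : IsManifold 𝓘(ℝ, E) 1 M := IsManifold.of_le (n := ∞) (by simp)
  have h := mfderivWithin_range_extChartAt_symm (I := 𝓘(ℝ, E)) (x := x₀)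
  rw [ModelWithCorners.range_eq_univ, mfderivWithin_univ] at h
  rw [h]
  rfl

variable [IsManifold 𝓘(ℝ, E) ∞ M]

theorem contDiffOn_localFun {f : M → ℝ} (hf : ContMDiff 𝓘(ℝ, E) 𝓘(ℝ, ℝ) ∞ f) (x₀ : M) :
    ContDiffOn ℝ ∞ (localFun 𝓘(ℝ, E) f x₀) (extChartAt 𝓘(ℝ, E) x₀).target := by
  rw [← contMDiffOn_iff_contDiffOn]
  exact hf.comp_contMDiffOn (contMDiffOn_extChartAt_symm x₀)

/-- A coordinate vector field is the tangent map of the inverse chart applied to a constant field.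
-/
theorem contMDiffOn_mfderiv_extChartAt_symm (x₀ : M) (u : E) :
    ContMDiffOn 𝓘(ℝ, E) (𝓘(ℝ, E).prod 𝓘(ℝ, E)) ∞
      (fun z => Bundle.TotalSpace.mk' E (E := (TangentSpace 𝓘(ℝ, E) : M → Type _))
        ((extChartAt 𝓘(ℝ, E) x₀).symm z)
        (mfderiv 𝓘(ℝ, E) 𝓘(ℝ, E) (extChartAt 𝓘(ℝ, E) x₀).symm z u))
      (extChartAt 𝓘(ℝ, E) x₀).target := by
  have hopen : IsOpen (extChartAt 𝓘(ℝ, E) x₀).target := isOpen_extChartAt_target x₀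
  have h1 := (contMDiffOn_extChartAt_symm (I := 𝓘(ℝ, E)) (n := ∞) x₀).contMDiffOn_tangentMapWithin
    (m := ∞) (by simp) hopen.uniqueMDiffOn
  have h2 : ContMDiff 𝓘(ℝ, E) (𝓘(ℝ, E).prod 𝓘(ℝ, E)) ∞ (fun z : E =>
      Bundle.TotalSpace.mk' E (E := (TangentSpace 𝓘(ℝ, E) : E → Type _)) z u) :=
    fun z => contMDiffAt_vectorSpace_iff_contDiffAt.2 contDiffAt_const
  have h3 : ContMDiffOn 𝓘(ℝ, E) (𝓘(ℝ, E).prod 𝓘(ℝ, E)) ∞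
      (tangentMapWithin 𝓘(ℝ, E) 𝓘(ℝ, E) (extChartAt 𝓘(ℝ, E) x₀).symm
        (extChartAt 𝓘(ℝ, E) x₀).target ∘ fun z : E =>
          Bundle.TotalSpace.mk' E (E := (TangentSpace 𝓘(ℝ, E) : E → Type _)) z u)
      (extChartAt 𝓘(ℝ, E) x₀).target :=
    h1.comp h2.contMDiffOn fun z hz => hz
  refine h3.congr fun z hz => ?_
  simp only [Function.comp, tangentMapWithin]
  rw [mfderivWithin_of_isOpen hopen hz]

theorem localForm_self (g : BilinField 𝓘(ℝ, E) M) (x : M) (v w : E) :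
    localForm g x (extChartAt 𝓘(ℝ, E) x x) v w = g x v w := by
  rw [localForm_apply, mfderiv_extChartAt_symm_self, mfderiv_extChartAt_symm_self]
  rw [extChartAt_to_inv]

theorem IsSemiRiemannianMetric.isMetricOn_localForm [FiniteDimensional ℝ E]
    {g : BilinField 𝓘(ℝ, E) M} (hg : IsSemiRiemannianMetric g) (x₀ : M) :
    IsMetricOn (localForm g x₀) (extChartAt 𝓘(ℝ, E) x₀).target where
  isOpen := isOpen_extChartAt_target x₀
  smooth := by
    refine contDiffOn_bilin_of_apply fun u v => ?_
    rw [← contMDiffOn_iff_contDiffOn]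
    -- Each coefficient is the smooth metric evaluated on two smooth coordinate fields, viewed as a
    -- section of the trivial line bundle; its second component is the scalar function.
    have h := ContMDiffOn.clm_bundle_apply₂ (F₁ := E) (F₂ := E) (F₃ := ℝ)
      (E₃ := Bundle.Trivial M ℝ)
      (hg.smooth.comp_contMDiffOn (contMDiffOn_extChartAt_symm x₀))
      (contMDiffOn_mfderiv_extChartAt_symm x₀ u) (contMDiffOn_mfderiv_extChartAt_symm x₀ v)
    intro z hz
    have h' := h z hz
    rw [Bundle.contMDiffWithinAt_totalSpace] at h'
    exact h'.2
  symm := fun y _ u v => by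
    rw [localForm_apply, localForm_apply, hg.symm]
  invertible := fun y hy => by
    obtain ⟨D, hD⟩ := isInvertible_mfderiv_extChartAt_symm x₀ hy
    refine isInvertible_of_nondegenerate fun v hv => ?_
    -- The differential `D` is onto, so a vector degenerate for the local form is mapped to one
    -- degenerate for `g`.
    have h0 : D v = 0 := by
      refine hg.nondegenerate _ _ fun w => ?_
      have h1 : localForm g x₀ y v (D.symm w) = _ := localForm_apply g x₀ y v (D.symm w)
      rw [← hD] at h1
      have h2 : D (D.symm w) = w := D.apply_symm_apply w
      exact (congrArg _ h2.symm).trans (h1.symm.trans (hv (D.symm w)))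
    exact D.injective (h0.trans (map_zero D).symm)

end Chart

namespace LocalMetric

/-! ### Local invariants depend only on the germ of the metric -/

section Congr

variable {E : Type*} [NormedAddCommGroup E] [NormedSpace ℝ E]
  {G G' : E → E →L[ℝ] E →L[ℝ] ℝ} {y : E}

theorem christoffel_congr (h : G =ᶠ[nhds y] G') (u v : E) :
    christoffel G y u v = christoffel G' y u v := by
  simp only [christoffel, sharp, christoffelLower, h.eq_of_nhds, h.fderiv_eq]

/-- Metrics with equal germs have Christoffel symbols with equal germs, so one more derivative may
be taken. The same argument, applied to the curvature, gives `nablaRiem_congr`. -/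
theorem curvOp_congr (h : G =ᶠ[nhds y] G') (u v w : E) :
    curvOp G y u v w = curvOp G' y u v w := by
  have h1 : ∀ a b : E, (fun z => christoffel G z a b) =ᶠ[nhds y] fun z => christoffel G' z a b :=
    fun a b => by
      filter_upwards [h.eventuallyEq_nhds] with z hz using christoffel_congr hz a b
  simp only [curvOp, christoffel_congr h, (h1 _ _).fderiv_eq]

theorem riem_congr (h : G =ᶠ[nhds y] G') (i j k l : E) : riem G y i j k l = riem G' y i j k l := by
  rw [riem, riem, curvOp_congr h, h.eq_of_nhds]

theorem nablaRiem_congr (h : G =ᶠ[nhds y] G') (e i j k l : E) :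
    nablaRiem G y e i j k l = nablaRiem G' y e i j k l := by
  have h1 : (fun z => riem G z i j k l) =ᶠ[nhds y] fun z => riem G' z i j k l := by
    filter_upwards [h.eventuallyEq_nhds] with z hz using riem_congr hz i j k l
  simp only [nablaRiem, covDeriv₄, h1.fderiv_eq, christoffel_congr h, riem_congr h]

theorem ricci_congr [FiniteDimensional ℝ E] (h : G =ᶠ[nhds y] G') (j k : E) :
    ricci G y j k = ricci G' y j k := by
  simp only [ricci, curvOp_congr h]

end Congr

end LocalMetric

/-! ### The warped product in a product chart -/

section WarpedChart

open LocalMetric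

variable {E₁ : Type*} [NormedAddCommGroup E₁] [NormedSpace ℝ E₁]
  {E₂ : Type*} [NormedAddCommGroup E₂] [NormedSpace ℝ E₂]
  {B : Type*} [TopologicalSpace B] [ChartedSpace E₁ B] [IsManifold 𝓘(ℝ, E₁) ∞ B]
  {F : Type*} [TopologicalSpace F] [ChartedSpace E₂ F] [IsManifold 𝓘(ℝ, E₂) ∞ F]

theorem extChartAt_prod_symm_apply (x : B × F) (z : E₁ × E₂) :
    (extChartAt (𝓘(ℝ, E₁).prod 𝓘(ℝ, E₂)) x).symm z =
      ((extChartAt 𝓘(ℝ, E₁) x.1).symm z.1, (extChartAt 𝓘(ℝ, E₂) x.2).symm z.2) := by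
  rw [extChartAt_prod]
  rfl

theorem mdifferentiableAt_extChartAt_prod_symm (x : B × F) {z : E₁ × E₂}
    (hz : z ∈ (extChartAt 𝓘(ℝ, E₁) x.1).target ×ˢ (extChartAt 𝓘(ℝ, E₂) x.2).target) :
    MDifferentiableAt 𝓘(ℝ, E₁ × E₂) (𝓘(ℝ, E₁).prod 𝓘(ℝ, E₂))
      (extChartAt (𝓘(ℝ, E₁).prod 𝓘(ℝ, E₂)) x).symm z := by
  have : IsManifold 𝓘(ℝ, E₁) 1 B := IsManifold.of_le (n := ∞) (by simp)
  have : IsManifold 𝓘(ℝ, E₂) 1 F := IsManifold.of_le (n := ∞) (by simp)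
  have hz' : z ∈ (extChartAt (𝓘(ℝ, E₁).prod 𝓘(ℝ, E₂)) x).target := by
    rw [extChartAt_prod]
    exact hz
  exact (mdifferentiableOn_extChartAt_symm z hz').mdifferentiableAt
    ((isOpen_extChartAt_target x).mem_nhds hz')

theorem mdifferentiableAt_extChartAt_symm {E : Type*} [NormedAddCommGroup E] [NormedSpace ℝ E]
    {M : Type*} [TopologicalSpace M] [ChartedSpace E M] [IsManifold 𝓘(ℝ, E) ∞ M] (x : M) {z : E}
    (hz : z ∈ (extChartAt 𝓘(ℝ, E) x).target) :
    MDifferentiableAt 𝓘(ℝ, E) 𝓘(ℝ, E) (extChartAt 𝓘(ℝ, E) x).symm z := by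
  have : IsManifold 𝓘(ℝ, E) 1 M := IsManifold.of_le (n := ∞) (by simp)
  exact (mdifferentiableOn_extChartAt_symm z hz).mdifferentiableAt
    ((isOpen_extChartAt_target x).mem_nhds hz)

/-- Projecting commutes with the inverse charts; the two chain rules for the common composite are
compared. -/
theorem mfderiv_fst_extChartAt_prod_symm (x : B × F) {z : E₁ × E₂}
    (hz : z ∈ (extChartAt 𝓘(ℝ, E₁) x.1).target ×ˢ (extChartAt 𝓘(ℝ, E₂) x.2).target)
    (u : E₁ × E₂) :
    mfderiv (𝓘(ℝ, E₁).prod 𝓘(ℝ, E₂)) 𝓘(ℝ, E₁) Prod.fst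
        ((extChartAt (𝓘(ℝ, E₁).prod 𝓘(ℝ, E₂)) x).symm z)
        (mfderiv 𝓘(ℝ, E₁ × E₂) (𝓘(ℝ, E₁).prod 𝓘(ℝ, E₂))
          (extChartAt (𝓘(ℝ, E₁).prod 𝓘(ℝ, E₂)) x).symm z u) =
      mfderiv 𝓘(ℝ, E₁) 𝓘(ℝ, E₁) (extChartAt 𝓘(ℝ, E₁) x.1).symm z.1 u.1 := by
  have h1 := mfderiv_comp z (mdifferentiableAt_fst (I := 𝓘(ℝ, E₁)) (I' := 𝓘(ℝ, E₂)))
    (mdifferentiableAt_extChartAt_prod_symm x hz)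
  have hf : HasMFDerivAt 𝓘(ℝ, E₁ × E₂) 𝓘(ℝ, E₁) (Prod.fst : E₁ × E₂ → E₁) z
      (ContinuousLinearMap.fst ℝ E₁ E₂) := hasFDerivAt_fst.hasMFDerivAt
  have h2 := mfderiv_comp z (mdifferentiableAt_extChartAt_symm x.1 hz.1) hf.mdifferentiableAt
  rw [hf.mfderiv] at h2
  have h3 : Prod.fst ∘ (extChartAt (𝓘(ℝ, E₁).prod 𝓘(ℝ, E₂)) x).symm =
      (extChartAt 𝓘(ℝ, E₁) x.1).symm ∘ (Prod.fst : E₁ × E₂ → E₁) :=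
    funext fun w => congrArg Prod.fst (extChartAt_prod_symm_apply x w)
  rw [h3] at h1
  exact congrArg (fun L : E₁ × E₂ →L[ℝ] E₁ => L u) (h1.symm.trans h2)

theorem mfderiv_snd_extChartAt_prod_symm (x : B × F) {z : E₁ × E₂}
    (hz : z ∈ (extChartAt 𝓘(ℝ, E₁) x.1).target ×ˢ (extChartAt 𝓘(ℝ, E₂) x.2).target)
    (u : E₁ × E₂) :
    mfderiv (𝓘(ℝ, E₁).prod 𝓘(ℝ, E₂)) 𝓘(ℝ, E₂) Prod.snd
        ((extChartAt (𝓘(ℝ, E₁).prod 𝓘(ℝ, E₂)) x).symm z)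
        (mfderiv 𝓘(ℝ, E₁ × E₂) (𝓘(ℝ, E₁).prod 𝓘(ℝ, E₂))
          (extChartAt (𝓘(ℝ, E₁).prod 𝓘(ℝ, E₂)) x).symm z u) =
      mfderiv 𝓘(ℝ, E₂) 𝓘(ℝ, E₂) (extChartAt 𝓘(ℝ, E₂) x.2).symm z.2 u.2 := by
  have h1 := mfderiv_comp z (mdifferentiableAt_snd (I := 𝓘(ℝ, E₁)) (I' := 𝓘(ℝ, E₂)))
    (mdifferentiableAt_extChartAt_prod_symm x hz)
  have hf : HasMFDerivAt 𝓘(ℝ, E₁ × E₂) 𝓘(ℝ, E₂) (Prod.snd : E₁ × E₂ → E₂) z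
      (ContinuousLinearMap.snd ℝ E₁ E₂) := hasFDerivAt_snd.hasMFDerivAt
  have h2 := mfderiv_comp z (mdifferentiableAt_extChartAt_symm x.2 hz.2) hf.mdifferentiableAt
  rw [hf.mfderiv] at h2
  have h3 : Prod.snd ∘ (extChartAt (𝓘(ℝ, E₁).prod 𝓘(ℝ, E₂)) x).symm =
      (extChartAt 𝓘(ℝ, E₂) x.2).symm ∘ (Prod.snd : E₁ × E₂ → E₂) :=
    funext fun w => congrArg Prod.snd (extChartAt_prod_symm_apply x w)
  rw [h3] at h1
  exact congrArg (fun L : E₁ × E₂ →L[ℝ] E₂ => L u) (h1.symm.trans h2)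

/-- In a product chart, a warped product metric is the warped product of the local metrics. -/
theorem localForm_warpedMetric (g₁ : BilinField 𝓘(ℝ, E₁) B) (g₂ : BilinField 𝓘(ℝ, E₂) F)
    (f : B → ℝ) (x : B × F) {z : E₁ × E₂}
    (hz : z ∈ (extChartAt 𝓘(ℝ, E₁) x.1).target ×ˢ (extChartAt 𝓘(ℝ, E₂) x.2).target) :
    localForm (warpedMetric g₁ g₂ f) x z =
      warped (localForm g₁ x.1) (localForm g₂ x.2) (localFun 𝓘(ℝ, E₁) f x.1) z := by
  refine ContinuousLinearMap.ext fun u => ContinuousLinearMap.ext fun v => ?_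
  rw [warped_apply, localForm_apply, warpedMetric_apply, localForm_apply, localForm_apply]
  rw [mfderiv_fst_extChartAt_prod_symm x hz, mfderiv_fst_extChartAt_prod_symm x hz,
    mfderiv_snd_extChartAt_prod_symm x hz, mfderiv_snd_extChartAt_prod_symm x hz,
    extChartAt_prod_symm_apply]
  rfl

/-- Transfers `hgk_iff` to the manifold: both the identity and the system are defined through local
forms at the centers of the charts, and the chart at `x` is a product. -/
theorem hgkEquationAt_iff [FiniteDimensional ℝ E₁] [FiniteDimensional ℝ E₂]
    (hdim : 1 ≤ Module.finrank ℝ E₂)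
    (g₁ : BilinField 𝓘(ℝ, E₁) B) (hg₁ : IsSemiRiemannianMetric g₁)
    (g₂ : BilinField 𝓘(ℝ, E₂) F) (hg₂ : IsSemiRiemannianMetric g₂)
    (f : B → ℝ) (hf : ContMDiff 𝓘(ℝ, E₁) 𝓘(ℝ, ℝ) ∞ f) (hf_pos : ∀ x, 0 < f x)
    (Pi Psi : CovectorField (𝓘(ℝ, E₁).prod 𝓘(ℝ, E₂)) (B × F)) (x : B × F) :
    HGKEquationAt (warpedMetric g₁ g₂ f) Pi Psi x ↔ HGKSystemAt g₁ g₂ f Pi Psi x := by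
  set U₁ := (extChartAt 𝓘(ℝ, E₁) x.1).target
  set U₂ := (extChartAt 𝓘(ℝ, E₂) x.2).target
  set y : E₁ × E₂ := (extChartAt 𝓘(ℝ, E₁) x.1 x.1, extChartAt 𝓘(ℝ, E₂) x.2 x.2)
  have hy : y ∈ U₁ ×ˢ U₂ := ⟨mem_extChartAt_target x.1, mem_extChartAt_target x.2⟩
  have hext : extChartAt (𝓘(ℝ, E₁).prod 𝓘(ℝ, E₂)) x x = y := by
    rw [extChartAt_prod]
    rfl
  have h : IsWarpedAt (localForm g₁ x.1) (localForm g₂ x.2) (localFun 𝓘(ℝ, E₁) f x.1) U₁ U₂ :=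
    { base := hg₁.isMetricOn_localForm x.1
      fiber := hg₂.isMetricOn_localForm x.2
      smooth := contDiffOn_localFun hf x.1
      ne_zero := fun z _ => (hf_pos _).ne' }
  -- Equality at the center alone would not suffice, since `∇R` involves three derivatives of the
  -- metric; the two fields agree on a neighborhood.
  have hgerm : localForm (warpedMetric g₁ g₂ f) x =ᶠ[nhds y]
      warped (localForm g₁ x.1) (localForm g₂ x.2) (localFun 𝓘(ℝ, E₁) f x.1) := by
    filter_upwards [h.isMetricOn.mem_nhds hy] with z hz
    exact localForm_warpedMetric g₁ g₂ f x hz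
  have hf0 : localFun 𝓘(ℝ, E₁) f x.1 y.1 = f x.1 := by
    rw [localFun, extChartAt_to_inv]
  have hw : ∀ v w : E₁ × E₂, warpedMetric g₁ g₂ f x v w =
      warped (localForm g₁ x.1) (localForm g₂ x.2) (localFun 𝓘(ℝ, E₁) f x.1) y v w := by
    intro v w
    refine (warpedMetric_apply g₁ g₂ f x v w).trans ?_
    rw [warped_apply, localForm_self, localForm_self, hf0, mfderiv_fst, mfderiv_snd]
    rfl
  have hn : ∀ e i j k l : E₁ × E₂, _root_.nablaRiem (warpedMetric g₁ g₂ f) x e i j k l =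
      LocalMetric.nablaRiem
        (warped (localForm g₁ x.1) (localForm g₂ x.2) (localFun 𝓘(ℝ, E₁) f x.1)) y e i j k l :=
    fun e i j k l => (congrArg (fun w => LocalMetric.nablaRiem (localForm (warpedMetric g₁ g₂ f) x) w e i j k l) hext).trans
      (nablaRiem_congr hgerm e i j k l)
  have hr : ∀ i j k l : E₁ × E₂, Riem (warpedMetric g₁ g₂ f) x i j k l =
      riem (warped (localForm g₁ x.1) (localForm g₂ x.2) (localFun 𝓘(ℝ, E₁) f x.1)) y i j k l :=
    fun i j k l => (congrArg (fun w => riem (localForm (warpedMetric g₁ g₂ f) x) w i j k l) hext).trans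
      (riem_congr hgerm i j k l)
  have hs : ∀ j k : E₁ × E₂, Ricci (warpedMetric g₁ g₂ f) x j k =
      ricci (warped (localForm g₁ x.1) (localForm g₂ x.2) (localFun 𝓘(ℝ, E₁) f x.1)) y j k :=
    fun j k => (congrArg (fun w => ricci (localForm (warpedMetric g₁ g₂ f) x) w j k) hext).trans
      (ricci_congr hgerm j k)
  have hk : ∀ i j k l : E₁ × E₂, kulkarniNomizu (fun v w : E₁ × E₂ => warpedMetric g₁ g₂ f x v w)
      (Ricci (warpedMetric g₁ g₂ f) x) i j k l =
      kulkarniNomizu (fun v w => warped (localForm g₁ x.1) (localForm g₂ x.2)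
          (localFun 𝓘(ℝ, E₁) f x.1) y v w)
        (ricci (warped (localForm g₁ x.1) (localForm g₂ x.2) (localFun 𝓘(ℝ, E₁) f x.1)) y)
        i j k l := by
    intro i j k l
    simp only [kulkarniNomizu, hw, hs]
  -- The two `rfl` fix `m` as the fiber dimension and `Q` by its defining formula.
  have key := h.hgk_iff hy hdim (Pi x) (Psi x) _ _ rfl rfl
  have h₁ : ∀ v w : E₁, localForm g₁ x.1 y.1 v w = g₁ x.1 v w := localForm_self g₁ x.1
  have h₂ : ∀ v w : E₂, localForm g₂ x.2 y.2 v w = g₂ x.2 v w := localForm_self g₂ x.2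
  simp only [h₁, h₂, hf0] at key
  refine Iff.trans (forall_congr' fun e => forall_congr' fun i => forall_congr' fun j =>
    forall_congr' fun k => forall_congr' fun l => ?_) (key.trans ?_)
  · exact Iff.of_eq (congrArg₂ _ (hn e i j k l) (congrArg₂ _ (congrArg _ (hr i j k l))
      (congrArg _ (hk i j k l))))
  constructor
  · rintro ⟨bb, bf, fb, ff, mb, mf, gc, dc⟩
    exact ⟨bb, bf, fb, ff, mb, mf, gc, dc⟩
  · rintro ⟨bb, bf, fb, ff, mb, mf, gc, dc⟩
    exact ⟨bb, bf, fb, ff, mb, mf, gc, dc⟩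

end WarpedChart

end

/-- A warped product `B ×_f F` of semi-Riemannian manifolds is hyper generalized recurrent with
associated 1-forms `(Π, Ψ)` if and only if the system of tensor identities on base and fiber holds
at every point of the set to which the defining identity refers; more precisely, at each single
point the defining identity is equivalent to the system. -/
theorem corollary4p7
    {E₁ : Type*} [NormedAddCommGroup E₁] [NormedSpace ℝ E₁] [FiniteDimensional ℝ E₁]
    {E₂ : Type*} [NormedAddCommGroup E₂] [NormedSpace ℝ E₂] [FiniteDimensional ℝ E₂]
    {B : Type*} [TopologicalSpace B] [ChartedSpace E₁ B] [IsManifold 𝓘(ℝ, E₁) ∞ B]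
    {F : Type*} [TopologicalSpace F] [ChartedSpace E₂ F] [IsManifold 𝓘(ℝ, E₂) ∞ F]
    (hdim : 1 ≤ Module.finrank ℝ E₂)
    (g₁ : BilinField 𝓘(ℝ, E₁) B) (hg₁ : IsSemiRiemannianMetric g₁)
    (g₂ : BilinField 𝓘(ℝ, E₂) F) (hg₂ : IsSemiRiemannianMetric g₂)
    (f : B → ℝ) (hf : ContMDiff 𝓘(ℝ, E₁) 𝓘(ℝ, ℝ) ∞ f) (hf_pos : ∀ x, 0 < f x)
    (Pi Psi : CovectorField (𝓘(ℝ, E₁).prod 𝓘(ℝ, E₂)) (B × F))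
    (hPi : IsSmoothOneForm Pi) (hPsi : IsSmoothOneForm Psi) :
    (IsHGK (warpedMetric g₁ g₂ f) Pi Psi ↔
      ∀ x ∈ nonRecurrentSet (warpedMetric g₁ g₂ f), HGKSystemAt g₁ g₂ f Pi Psi x) ∧
    (∀ x : B × F, HGKEquationAt (warpedMetric g₁ g₂ f) Pi Psi x ↔
      HGKSystemAt g₁ g₂ f Pi Psi x) := by
  have h := hgkEquationAt_iff hdim g₁ hg₁ g₂ hg₂ f hf hf_pos Pi Psi
  exact ⟨forall₂_congr fun x _ => h x, h⟩
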